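/- Let $S=k[x_1,\dots,x_n]$ be a polynomial ring over a field $k$, and let $M\subsetneq S$ be a proper monomial ideal minimally generated by monomials $m_1,\dots,m_r$. **Notation.** Let $L_M$ be the lcm-lattice of $M$: the least common multiples of the subsets of $\{m_1,\dots,m_r\}$, ordered by divisibility, with bottom element $1$ and atoms $m_1,\dots,m_r$. For $m\in L_M$ put $A_m=\{i : m_i\mid m\}$ and $(M_{\le m})=(m_i : i\in A_m)$. Let $\Omega$ be the simplex on $\{1,\dots,r\}$ with boundary map $d$ (the empty face $\emptyset$ is a face, and $d\{i\}=\emptyset$), and let $\Omega_m\subseteq\Omega$ be the simplex on $A_m$. A chain is a $k$-linear combination of faces of the same dimension; its support is the union of the faces that occur in it. A face $A$ has multidegree $\mathrm{lcm}(m_i : i\in A)$, and a chain $c$ has multidegree $\mathrm{mdeg}(c)$, the lcm of the multidegrees of the faces that occur in it. The closure $\overline{A}$ of $A\subseteq\{1,\dots,r\}$ is the intersection of all sets $A_m\supseteq A$, $m\in L_M$. A chain $c$ is a *Taylor chain at $m$* if some face $A$ occurring in $c$ satisfies $\overline{A}=\overline{\mathrm{supp}(c)}=A_m$. All complexes are finite,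 vanish in negative degrees and carry a fixed (multigraded, over $S$) basis; a chain of faces with $i$ vertices is placed in homological degree $i$. A *subcomplex* is spanned by a subset of the fixed basis. A *trivial complex* is a direct sum of complexes $0\to k\xrightarrow{1}k\to0$ (over $S$: $0\to S(-m)\xrightarrow{1}S(-m)\to 0$) in various degrees. An *exact closure* of a complex $\mathbb U$ of $k$-vector spaces is an exact complex that contains $\mathbb U$ as a subcomplex and has the least total dimension among all such complexes. **Construction.** Sets $\Gamma_m$ ($m\in L_M$) of chains are chosen inductively. Put $\Gamma_1=\{\emptyset\}$ and $\Gamma_{m_i}=\{\{i\}\}$. If $m$ is neither $1$ nor an atom, let $(\mathbb U_m,d)$ be the complex with basis $\bigcup_{\widetilde m<m}\Gamma_{\widetilde m}$ obtained by applying $d$ to these chains, and choose an exact closure $(\mathbb V_m,\partial)$ of it; replace each basis element $f$ of $\mathbb V_m$ not in $\mathbb U_m$ by a chain $g$ in $\Omega_m$ with $d(g)=\partial(f)$, and let $\Gamma_m$ be the set of these chains $g$. In all cases $(\mathbb V_m,d)$ denotes the complex with basis $\bigcup_{\widetilde m\le m}\Gamma_{\widetilde m}$ obtained by applying $d$, and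 $\mathbb V(L_M)=\mathbb V_{\mathrm{lcm}(m_1,\dots,m_r)}$. **Homogenization.** A complex $\mathbb V$ of $k$-vector spaces is a *frame* for $(m_i)_{i\in X}$ if $V_0$ has one basis element $o$, $V_1$ has a basis $(w_i)_{i\in X}$, and $\partial w_i=o$ for all $i$. Its homogenization is the multigraded complex of free $S$-modules on the same basis in which $o$ has multidegree $1$, $w_i$ has multidegree $m_i$, a basis element $u$ of degree $\ge2$ has as multidegree the lcm of the multidegrees of the basis elements occurring in $\partial u$, and an entry $\lambda$ of $\partial$, the coefficient of $v$ in $\partial u$, is replaced by $\lambda\,\mathrm{mdeg}(u)/\mathrm{mdeg}(v)$. Likewise, a complex whose basis consists of chains $c$ is homogenized by giving $c$ the multidegree $\mathrm{mdeg}(c)$ and changing the entries in the same way, provided that these quotients are monomials whenever $\lambda\ne0$. The Taylor resolution $\mathbf T$ of $S/(M_{\le m})$ is the homogenization of $\widetilde C(\Omega_m;k)[-1]$ with the faces as basis. Chains $g_1,\dots,g_q$ form a *Taylor basis* of a minimal free resolution $\mathbf F$ of $S/(M_{\le m})$ with fixed basis $e_1,\dots,e_q$ if there are a trivial complex $\mathcal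 E$ and an isomorphism $\mathbf F\oplus\mathcal E\cong\mathbf T$ of multigraded complexes such that $g_j$ is obtained from the image of $e_j$ in $\mathbf T$ by setting $x_1=\dots=x_n=1$. **Theorem.** Let $\Gamma_m$, $\mathbb V_m$ be obtained by any run of the construction. 1. For every $m\ne1$ in $L_M$, every element of $\Gamma_m$ is a Taylor chain at $m$. 2. There are sets $P_m$ ($1\neq m\in L_M$) of Taylor chains at $m$ such that, for every $m\ne 1$, applying $d$ to the chains in $P_m$ gives a direct sum $(\mathcal E_m,d)$ of short trivial complexes; the chains in $\bigcup_{\widetilde m\le m}\Gamma_{\widetilde m}\cup\bigcup_{1\ne\widetilde m\le m}P_{\widetilde m}$ are linearly independent, and the complex $(\mathbb W_m,d)$ obtained by applying $d$ to them satisfies $$(\mathbb W_m,d)=(\mathbb V_m,d)\oplus\bigoplus_{1\ne\widetilde m\le m}(\mathcal E_{\widetilde m},d)\;\cong\;\widetilde C(\Omega_m;k)[-1];$$ and the homogenization of $\mathbb W_m$ by the multidegrees of its basis chains is defined and is isomorphic, as a multigraded complex, to the Taylor resolution of $S/(M_{\le m})$. 3. For every $m\ne1$ in $L_M$, $\mathbb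 V_m$ is a frame for $(m_i)_{i\in A_m}$ with $w_i=\{i\}$, and its homogenization is a minimal free resolution of $S/(M_{\le m})$ with Taylor basis $\bigcup_{\widetilde m\le m}\Gamma_{\widetilde m}$. 4. In particular, $\mathbb V(L_M)$ is an $r$-frame, and its $M$-homogenization is a minimal free resolution of $S/M$ (an *atomic lattice resolution*) with Taylor basis $\bigcup_{m\in L_M}\Gamma_m$. -/

import Mathlib

open MvPolynomial

noncomputable section

/-! ### Finite complexes of free modules with a fixed homogeneous basis -/

/-- A finite complex `0 → F_l → ⋯ → F_1 → F_0 → 0` of finitely generated free `R`-modules with a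
fixed basis. The basis elements of all the `F_i` are collected in one finite type `ι`, the element
`j` lying in homological degree `deg j`, and the differential is given by its matrix:
`d j = ∑ i, D i j • i`. -/
structure BasedComplex (R : Type*) [CommRing R] where
  ι : Type
  [fintype : Fintype ι]
  [decEq : DecidableEq ι]
  deg : ι → ℕ
  D : Matrix ι ι R
  deg_eq : ∀ i j, D i j ≠ 0 → deg j = deg i + 1
  sq_zero : D * D = 0

attribute [instance] BasedComplex.fintype BasedComplex.decEq

namespace BasedComplex

variable {R : Type*} [CommRing R]

/-- The elements of the free module in homological degree `i`. -/
def InDegree (U : BasedComplex R) (i : ℕ) (x : U.ι → R) : Prop :=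
  ∀ j, x j ≠ 0 → U.deg j = i

/-- Exactness at homological degree `i`. -/
def ExactAt (U : BasedComplex R) (i : ℕ) : Prop :=
  ∀ x, U.InDegree i x → U.D.mulVec x = 0 → ∃ y, U.InDegree (i + 1) y ∧ U.D.mulVec y = x

def IsExact (U : BasedComplex R) : Prop := ∀ i, U.ExactAt i

/-- `φ` maps the fixed basis of `U` bijectively to a part of the fixed basis of `V` that spans a
subspace stable under the differential, and the resulting complex is `U`. -/
structure IsSubcomplex (U V : BasedComplex R) (φ : U.ι → V.ι) : Prop where
  injective : Function.Injective φ
  deg_eq : ∀ i, V.deg (φ i) = U.deg i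
  D_eq : ∀ i j, V.D (φ i) (φ j) = U.D i j
  stable : ∀ v, v ∉ Set.range φ → ∀ j, V.D v (φ j) = 0

/-- `V` is an exact closure of `U` (embedded by `φ`): an exact complex that has `U` as a subcomplex,
of the smallest possible total dimension. -/
structure IsExactClosure (U V : BasedComplex R) (φ : U.ι → V.ι) : Prop where
  exact : V.IsExact
  subcomplex : IsSubcomplex U V φ
  minimal : ∀ (W : BasedComplex R) (ψ : U.ι → W.ι), W.IsExact → IsSubcomplex U W ψ →
    Fintype.card V.ι ≤ Fintype.card W.ι

/-- The matrix `Φ` is an isomorphism of complexes from `U` to `V`. -/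
structure IsIso (U V : BasedComplex R) (Φ : Matrix V.ι U.ι R) : Prop where
  deg_eq : ∀ v u, Φ v u ≠ 0 → V.deg v = U.deg u
  bijective : ∃ Ψ : Matrix U.ι V.ι R, Ψ * Φ = 1 ∧ Φ * Ψ = 1
  comm : Φ * U.D = V.D * Φ

/-- A direct sum of short trivial complexes `0 → R → R → 0` (with differential `1`): the basis
consists of pairs (source, target). -/
def IsTrivial (U : BasedComplex R) : Prop :=
  ∃ (Q : Type) (p : Q ⊕ Q ≃ U.ι),
    (∀ q, U.D (p (.inr q)) (p (.inl q)) = 1) ∧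
    ∀ i j, U.D i j ≠ 0 → ∃ q, i = p (.inr q) ∧ j = p (.inl q)

/-- The direct sum of two complexes. -/
def sum (U V : BasedComplex R) : BasedComplex R where
  ι := U.ι ⊕ V.ι
  deg := Sum.elim U.deg V.deg
  D := Matrix.fromBlocks U.D 0 0 V.D
  deg_eq := by
    rintro (i | i) (j | j) h
    · exact U.deg_eq i j h
    · exact absurd rfl h
    · exact absurd rfl h
    · exact V.deg_eq i j h
  sq_zero := by
    rw [Matrix.fromBlocks_multiply]
    simp [U.sq_zero, V.sq_zero]

/-- The direct sum of a finite family of complexes. -/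
def directSum {Q : Type} [Fintype Q] [DecidableEq Q] (U : Q → BasedComplex R) :
    BasedComplex R where
  ι := Σ q, (U q).ι
  deg x := (U x.1).deg x.2
  D := Matrix.blockDiagonal' fun q => (U q).D
  deg_eq := by
    rintro ⟨p, i⟩ ⟨q, j⟩ h
    by_cases hpq : p = q
    · subst hpq
      rw [Matrix.blockDiagonal'_apply_eq] at h
      exact (U p).deg_eq i j h
    · exact absurd (Matrix.blockDiagonal'_apply_ne _ _ _ hpq) h
  sq_zero := by
    rw [← Matrix.blockDiagonal'_mul]
    simp only [sq_zero]
    exact Matrix.blockDiagonal'_zero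

end BasedComplex

/-! ### Multigraded complexes over the polynomial ring -/

/-- A finite complex of multigraded free modules over `S = k[x_1, …, x_n]` with a fixed multigraded
basis. A monomial of `S` is represented by its exponent vector, so that divisibility is `≤`, the
least common multiple is `⊔` and the monomial `1` is `0`. -/
structure MultigradedComplex (k : Type*) [Field k] (n : ℕ) extends
    BasedComplex (MvPolynomial (Fin n) k) where
  mdeg : ι → (Fin n →₀ ℕ)
  multigraded : ∀ i j, D i j ≠ 0 →
    mdeg i ≤ mdeg j ∧ ∃ c : k, D i j = monomial (mdeg j - mdeg i) c

namespace MultigradedComplex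

variable {k : Type*} [Field k] {n : ℕ}

/-- The matrix `Φ` is an isomorphism of multigraded complexes from `F` to `G`. -/
structure IsIso (F G : MultigradedComplex k n)
    (Φ : Matrix G.ι F.ι (MvPolynomial (Fin n) k)) : Prop where
  toIsIso : F.toBasedComplex.IsIso G.toBasedComplex Φ
  multigraded : ∀ g f, Φ g f ≠ 0 →
    G.mdeg g ≤ F.mdeg f ∧ ∃ c : k, Φ g f = monomial (F.mdeg f - G.mdeg g) c

/-- The direct sum of two multigraded complexes. -/
def sum (F G : MultigradedComplex k n) : MultigradedComplex k n where
  toBasedComplex := F.toBasedComplex.sum G.toBasedComplex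
  mdeg := Sum.elim F.mdeg G.mdeg
  multigraded := by
    rintro (i | i) (j | j) h
    · exact F.multigraded i j h
    · exact absurd rfl h
    · exact absurd rfl h
    · exact G.multigraded i j h

/-- `F` is a multigraded free resolution of `S/M`: there is a multigraded augmentation `ε` from the
degree-`0` part of `F` onto `S/M` such that `⋯ → F_1 → F_0 → S/M → 0` is exact. -/
def IsFreeResolution (F : MultigradedComplex k n) (M : Ideal (MvPolynomial (Fin n) k)) : Prop :=
  (∀ i, 1 ≤ i → F.ExactAt i) ∧
  ∃ ε : (F.ι → MvPolynomial (Fin n) k) →ₗ[MvPolynomial (Fin n) k] MvPolynomial (Fin n) k ⧸ M,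
    (∀ j, F.deg j = 0 → ∃ c : k,
      ε (Pi.single j 1) = Ideal.Quotient.mk M (monomial (F.mdeg j) c)) ∧
    (∀ q, ∃ x, F.InDegree 0 x ∧ ε x = q) ∧
    (∀ x, F.InDegree 0 x → (ε x = 0 ↔ ∃ y, F.InDegree 1 y ∧ F.D.mulVec y = x))

/-- A free resolution is minimal if the entries of the matrices of the differential lie in the
maximal ideal `(x_1, …, x_n)`. -/
def IsMinimalFreeResolution (F : MultigradedComplex k n)
    (M : Ideal (MvPolynomial (Fin n) k)) : Prop :=
  F.IsFreeResolution M ∧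
    ∀ i j, F.D i j ∈ Ideal.span (Set.range (X : Fin n → MvPolynomial (Fin n) k))

end MultigradedComplex

namespace BasedComplex

variable {k : Type*} [Field k] {n : ℕ}

/-- The complex over `S` obtained from a complex of `k`-vector spaces by giving the basis element
`i` the multidegree `μ i` and replacing every entry `λ` of the differential by
`λ • (μ j / μ i)`. -/
def homogenizeWith (U : BasedComplex k) (μ : U.ι → (Fin n →₀ ℕ))
    (hμ : ∀ i j, U.D i j ≠ 0 → μ i ≤ μ j) : MultigradedComplex k n where
  ι := U.ι
  deg := U.deg
  D := Matrix.of fun i j => monomial (μ j - μ i) (U.D i j)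
  mdeg := μ
  deg_eq i j h := U.deg_eq i j fun h0 => h (by rw [Matrix.of_apply, h0, map_zero])
  sq_zero := by
    ext1 i j
    have key : ∀ t, (monomial (μ t - μ i) (U.D i t) : MvPolynomial (Fin n) k) *
        monomial (μ j - μ t) (U.D t j) = monomial (μ j - μ i) (U.D i t * U.D t j) := by
      intro t
      rw [monomial_mul]
      by_cases h1 : U.D i t = 0
      · simp [h1]
      by_cases h2 : U.D t j = 0
      · simp [h2]
      rw [add_comm, tsub_add_tsub_cancel (hμ t j h2) (hμ i t h1)]
    have h := congrFun (congrFun U.sq_zero i) j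
    simp only [Matrix.mul_apply, Matrix.zero_apply, Matrix.of_apply] at h ⊢
    simp only [key]
    rw [← map_sum, h, map_zero]
  multigraded i j h := ⟨hμ i j fun h0 => h (by rw [Matrix.of_apply, h0, map_zero]), _, rfl⟩

/-- A frame whose degree-`1` basis elements are labelled by `J` (an `r`-frame when `J` has `r`
elements): one basis element `o` in degree `0`, the basis elements `w t`, `t : J`, in degree `1`,
and `∂ (w t) = o`. -/
def IsFrame {R : Type*} [CommRing R] (U : BasedComplex R) {J : Type} (w : J → U.ι) : Prop :=
  ∃ o : U.ι, (∀ i, U.deg i = 0 ↔ i = o) ∧ Function.Injective w ∧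
    (∀ i, U.deg i = 1 ↔ i ∈ Set.range w) ∧ ∀ t, U.D o (w t) = 1

open Classical in
/-- Multidegrees in the homogenization, by recursion on the homological degree: `1` in degree `0`,
the monomial `m t` for the degree-`1` basis element `w t`, and in degrees `≥ 2` the least common
multiple of the multidegrees of the basis elements that occur in the differential. -/
def homMdegAux (U : BasedComplex k) {J : Type} [Fintype J] (w : J → U.ι)
    (m : J → (Fin n →₀ ℕ)) : ℕ → U.ι → (Fin n →₀ ℕ)
  | 0, _ => 0
  | 1, u => (Finset.univ.filter fun t => w t = u).sup m
  | i + 2, u => (Finset.univ.filter fun s => U.D s u ≠ 0).sup (homMdegAux U w m (i + 1))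

def homMdeg (U : BasedComplex k) {J : Type} [Fintype J] (w : J → U.ι)
    (m : J → (Fin n →₀ ℕ)) (u : U.ι) : Fin n →₀ ℕ :=
  U.homMdegAux w m (U.deg u) u

theorem homMdeg_le (U : BasedComplex k) {J : Type} [Fintype J] (w : J → U.ι)
    (m : J → (Fin n →₀ ℕ)) (i j : U.ι) (h : U.D i j ≠ 0) :
    U.homMdeg w m i ≤ U.homMdeg w m j := by
  have hd := U.deg_eq i j h
  unfold homMdeg
  rw [hd]
  rcases hi : U.deg i with _ | e
  · simp [homMdegAux]
  · rw [homMdegAux]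
    exact Finset.le_sup (f := U.homMdegAux w m (e + 1)) (by simpa using h)

/-- The `(m_t)_{t ∈ J}`-homogenization of a frame. -/
def homogenization (U : BasedComplex k) {J : Type} [Fintype J] (w : J → U.ι)
    (m : J → (Fin n →₀ ℕ)) : MultigradedComplex k n :=
  U.homogenizeWith (U.homMdeg w m) (U.homMdeg_le w m)

end BasedComplex

/-! ### Chains in the simplex on `r` vertices -/

/-- Chains in the simplex `Ω` with vertex set `Fin r`, the empty face included. The face `A` lies in
homological degree `|A|`; that is, this is the total space of `C̃(Ω; k)[-1]`. -/
abbrev Chain (k : Type*) (r : ℕ) := Finset (Fin r) → k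

/-- The incidence matrix of the boundary map `d`:
`d A = ∑_{v ∈ A} (-1)^{#{w ∈ A | w < v}} (A ∖ {v})`. -/
def boundaryMatrix (R : Type*) [CommRing R] (r : ℕ) :
    Matrix (Finset (Fin r)) (Finset (Fin r)) R :=
  fun B A => ∑ v ∈ A, if B = A.erase v then (-1) ^ (A.filter (· < v)).card else 0

theorem boundaryMatrix_ne_zero {R : Type*} [CommRing R] {r : ℕ} {B A : Finset (Fin r)}
    (h : boundaryMatrix R r B A ≠ 0) : ∃ v ∈ A, B = A.erase v := by
  obtain ⟨v, hv, hne⟩ := Finset.exists_ne_zero_of_sum_ne_zero h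
  exact ⟨v, hv, by by_contra hB; simp [hB] at hne⟩

theorem sign_swap {R : Type*} [CommRing R] {r : ℕ} (A : Finset (Fin r)) {v w : Fin r}
    (hv : v ∈ A) (hvw : v < w) :
    ((-1 : R) ^ (A.filter (· < v)).card * (-1) ^ ((A.erase v).filter (· < w)).card) +
      ((-1) ^ (A.filter (· < w)).card * (-1) ^ ((A.erase w).filter (· < v)).card) = 0 := by
  have h1 : ((A.erase w).filter (· < v)) = A.filter (· < v) := by
    ext x
    simp only [Finset.mem_filter, Finset.mem_erase]
    constructor
    · rintro ⟨⟨_, h⟩, h'⟩; exact ⟨h, h'⟩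
    · rintro ⟨h, h'⟩; exact ⟨⟨(h'.trans hvw).ne, h⟩, h'⟩
  have h2 : ((A.erase v).filter (· < w)) = (A.filter (· < w)).erase v := by
    rw [Finset.filter_erase]
  have hmem : v ∈ A.filter (· < w) := by simp [hv, hvw]
  have h3 := Finset.card_erase_add_one hmem
  rw [h1, h2, ← h3, pow_succ]
  ring

theorem boundaryMatrix_sq (R : Type*) [CommRing R] (r : ℕ) :
    boundaryMatrix R r * boundaryMatrix R r = 0 := by
  ext C A
  rw [Matrix.mul_apply, Matrix.zero_apply]
  have e1 : ∀ B, boundaryMatrix R r C B * boundaryMatrix R r B A =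
      ∑ v ∈ A, if B = A.erase v then
        boundaryMatrix R r C B * (-1) ^ (A.filter (· < v)).card else 0 := by
    intro B
    conv_lhs => rw [show boundaryMatrix R r B A = ∑ v ∈ A, if B = A.erase v then
      (-1) ^ (A.filter (· < v)).card else 0 from rfl]
    rw [Finset.mul_sum]
    exact Finset.sum_congr rfl fun v _ => by split_ifs <;> simp
  simp only [e1]
  rw [Finset.sum_comm]
  simp only [Finset.sum_ite_eq', Finset.mem_univ, if_true]
  simp only [boundaryMatrix, Finset.sum_mul]
  rw [Finset.sum_sigma']
  refine Finset.sum_involution (fun x _ => ⟨x.2, x.1⟩) ?_ ?_ ?_ ?_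
  · rintro ⟨v, w⟩ h
    simp only [Finset.mem_sigma, Finset.mem_erase] at h
    obtain ⟨hv, hwv, hw⟩ := h
    simp only [Finset.erase_right_comm (a := w) (b := v)]
    split_ifs with hC
    · rcases lt_or_gt_of_ne hwv with hlt | hlt
      · have := sign_swap (R := R) A hw hlt
        linear_combination this
      · have := sign_swap (R := R) A hv hlt
        linear_combination this
    · simp
  · rintro ⟨v, w⟩ h _ heq
    simp only [Finset.mem_sigma, Finset.mem_erase] at h
    exact h.2.1 (congrArg Sigma.fst heq)
  · rintro ⟨v, w⟩ h
    simp only [Finset.mem_sigma, Finset.mem_erase] at h ⊢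
    exact ⟨h.2.2, fun e => h.2.1 e.symm, h.1⟩
  · rintro ⟨v, w⟩ _
    rfl

/-- The complex `C̃(Ω_X; R)[-1]` of the simplex `Ω_X` with vertex set `X`, with the faces of `Ω_X`
(the empty face included) as its fixed basis. -/
def simplexComplex (R : Type*) [CommRing R] {r : ℕ} (X : Finset (Fin r)) : BasedComplex R where
  ι := {A : Finset (Fin r) // A ⊆ X}
  deg A := A.1.card
  D := Matrix.of fun B A => boundaryMatrix R r B.1 A.1
  deg_eq := by
    rintro ⟨B, hB⟩ ⟨A, hA⟩ h
    obtain ⟨v, hv, rfl⟩ := boundaryMatrix_ne_zero h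
    exact (Finset.card_erase_add_one hv).symm
  sq_zero := by
    ext ⟨C, hC⟩ ⟨A, hA⟩
    have h := congrFun (congrFun (boundaryMatrix_sq R r) C) A
    rw [Matrix.mul_apply, Matrix.zero_apply] at h ⊢
    rw [← h]
    refine Finset.sum_bij_ne_zero (fun B _ _ => B.1) (fun _ _ _ => Finset.mem_univ _)
      (fun _ _ _ _ _ _ e => Subtype.ext e) ?_ (fun _ _ _ => rfl)
    intro B _ hne
    obtain ⟨v, _, hB⟩ := boundaryMatrix_ne_zero (right_ne_zero_of_mul hne)
    exact ⟨⟨B, hB ▸ (Finset.erase_subset v A).trans hA⟩, Finset.mem_univ _, hne, rfl⟩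

section Chains

variable {k : Type*} [Field k] {n r : ℕ}

/-- The face `A`, as a chain. -/
def face (k : Type*) [Field k] {r : ℕ} (A : Finset (Fin r)) : Chain k r := Pi.single A 1

/-- The boundary map `d` of the simplex. -/
def boundary (c : Chain k r) : Chain k r := (boundaryMatrix k r).mulVec c

open Classical in
/-- The support of a chain: the union of the faces that occur in it. -/
def chainSupp (c : Chain k r) : Finset (Fin r) :=
  Finset.univ.filter fun i => ∃ A, c A ≠ 0 ∧ i ∈ A

open Classical in
/-- The multidegree of a chain: the least common multiple of the multidegrees
`lcm (m_i | i ∈ A)` of the faces `A` that occur in it. -/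
def chainMdeg (m : Fin r → (Fin n →₀ ℕ)) (c : Chain k r) : Fin n →₀ ℕ :=
  (Finset.univ.filter fun A => c A ≠ 0).sup fun A => A.sup m

/-- `U` is the complex with basis the set `B` of chains that is obtained by applying `d` to these
chains; `e` sends a basis element to the corresponding chain, a chain of faces with `i` vertices
being in homological degree `i`. -/
structure IsComplexOn (B : Set (Chain k r)) (U : BasedComplex k) (e : U.ι → Chain k r) : Prop where
  injective : Function.Injective e
  range_eq : Set.range e = B
  homogeneous : ∀ i A, e i A ≠ 0 → A.card = U.deg i
  boundary_eq : ∀ j, boundary (e j) = ∑ i, U.D i j • e i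

end Chains

/-! ### The construction along an atomic lattice -/

section Lattice

variable {L : Type} [PartialOrder L] {r : ℕ}

open Classical in
/-- The label `A_b` of `b`: the atoms below `b`. -/
def label (atom : Fin r → L) (b : L) : Finset (Fin r) :=
  Finset.univ.filter fun i => atom i ≤ b

open Classical in
/-- The closure of `A`: the intersection of all labels that contain `A`. -/
def labelClosure (atom : Fin r → L) (A : Finset (Fin r)) : Finset (Fin r) :=
  Finset.univ.filter fun i => ∀ b, A ⊆ label atom b → i ∈ label atom b

/-- `c` is a Taylor chain at `b`: some face of `c` has the same closure as the support of `c`, and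
this closure is `A_b`. -/
def IsTaylorChainAt {k : Type*} [Field k] (atom : Fin r → L) (b : L) (c : Chain k r) : Prop :=
  ∃ A, c A ≠ 0 ∧ labelClosure atom A = labelClosure atom (chainSupp c) ∧
    labelClosure atom (chainSupp c) = label atom b

/-- A run of the inductive construction of the sets `Γ b` of Taylor basis elements, for an atomic
lattice `L` with the atoms `atom 0, …, atom (r - 1)`.

`U b` and `V b` are the complexes obtained by applying the boundary map to `⋃_{b' < b} Γ b'` and to
`⋃_{b' ≤ b} Γ b'`. If `b` is neither the bottom element nor an atom, then `V b` is an exact closure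
of `U b` each of whose new basis elements `f` is given by a chain `g` in the simplex `Ω_b` such that
`d g` is the differential of `f`, and these chains are the elements of `Γ b`. -/
structure TaylorConstruction (k : Type*) [Field k] [OrderBot L] (atom : Fin r → L) where
  Γ : L → Set (Chain k r)
  U : L → BasedComplex k
  V : L → BasedComplex k
  chainU : ∀ b, (U b).ι → Chain k r
  chainV : ∀ b, (V b).ι → Chain k r
  Γ_bot : Γ ⊥ = {face k ∅}
  Γ_atom : ∀ i, Γ (atom i) = {face k {i}}
  complexU : ∀ b, IsComplexOn (⋃ b' < b, Γ b') (U b) (chainU b)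
  complexV : ∀ b, IsComplexOn (⋃ b' ≤ b, Γ b') (V b) (chainV b)
  step : ∀ b, b ≠ ⊥ → b ∉ Set.range atom →
    ∃ φ : (U b).ι → (V b).ι, (U b).IsExactClosure (V b) φ ∧
      (∀ i, chainV b (φ i) = chainU b i) ∧
      (∀ f, f ∉ Set.range φ → chainSupp (chainV b f) ⊆ label atom b) ∧
      Γ b = chainV b '' (Set.range φ)ᶜ

end Lattice

/-! ### The lcm-lattice, the Taylor resolution and Taylor bases -/

section Monomial

variable {n r : ℕ}

/-- The lcm-lattice of the monomials `m_i`: the least common multiples of their subsets, ordered by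
divisibility. -/
abbrev LcmLattice (m : Fin r → (Fin n →₀ ℕ)) : Type :=
  {u : Fin n →₀ ℕ // ∃ A : Finset (Fin r), A.sup m = u}

instance (m : Fin r → (Fin n →₀ ℕ)) : OrderBot (LcmLattice m) where
  bot := ⟨0, ∅, rfl⟩
  bot_le u := (zero_le : 0 ≤ u.1)

instance (m : Fin r → (Fin n →₀ ℕ)) : Finite (LcmLattice m) :=
  Finite.of_surjective (fun A : Finset (Fin r) => (⟨A.sup m, A, rfl⟩ : LcmLattice m))
    fun ⟨_, A, hA⟩ => ⟨A, Subtype.ext hA⟩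

/-- The top element `lcm (m_1, …, m_r)`. -/
def lcmTop (m : Fin r → (Fin n →₀ ℕ)) : LcmLattice m := ⟨Finset.univ.sup m, _, rfl⟩

/-- The atoms `m_i`. -/
def lcmAtom (m : Fin r → (Fin n →₀ ℕ)) (i : Fin r) : LcmLattice m :=
  ⟨m i, {i}, Finset.sup_singleton⟩

/-- The nontrivial elements below `u`. -/
abbrev LcmBelow {m : Fin r → (Fin n →₀ ℕ)} (u : LcmLattice m) : Type :=
  {v : LcmLattice m // v ≠ ⊥ ∧ v ≤ u}

instance {m : Fin r → (Fin n →₀ ℕ)} (u : LcmLattice m) : Fintype (LcmBelow u) :=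
  Fintype.ofFinite _

instance {m : Fin r → (Fin n →₀ ℕ)} (u : LcmLattice m) : DecidableEq (LcmBelow u) :=
  Classical.decEq _

variable {k : Type*} [Field k]

/-- The ideal generated by the monomials `m_i`, `i ∈ X`. -/
def monomialIdeal (k : Type*) [Field k] (m : Fin r → (Fin n →₀ ℕ)) (X : Finset (Fin r)) :
    Ideal (MvPolynomial (Fin n) k) :=
  Ideal.span ((fun i => monomial (m i) (1 : k)) '' (X : Set (Fin r)))

/-- The Taylor resolution of `S/(m_i | i ∈ X)`: its basis consists of the faces `A ⊆ X`, with
multidegrees `lcm (m_i | i ∈ A)`. -/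
def taylorComplex (k : Type*) [Field k] (m : Fin r → (Fin n →₀ ℕ)) (X : Finset (Fin r)) :
    MultigradedComplex k n :=
  (simplexComplex k X).homogenizeWith (fun A => A.1.sup m) fun B A h => by
    obtain ⟨v, _, hB⟩ := boundaryMatrix_ne_zero h
    rw [hB]
    exact Finset.sup_mono (Finset.erase_subset v A.1)

/-- The chains `g i` form a Taylor basis of the complex `F`: there are a trivial complex `E` and a
multigraded isomorphism from `F ⊕ E` to the Taylor resolution `T`, so that the images of the basis
elements of `F ⊕ E` are a new multigraded basis of `T`, and `g i` is the dehomogenization (the value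
at `x_1 = ⋯ = x_n = 1`) of the image of the basis element `i` of `F`. -/
def IsTaylorBasis (m : Fin r → (Fin n →₀ ℕ)) (X : Finset (Fin r)) (F : MultigradedComplex k n)
    (g : F.ι → Chain k r) : Prop :=
  ∃ E : MultigradedComplex k n, E.IsTrivial ∧
    ∃ Φ : Matrix (taylorComplex k m X).ι (F.sum E).ι (MvPolynomial (Fin n) k),
      (F.sum E).IsIso (taylorComplex k m X) Φ ∧
      ∀ i : F.ι, (∀ A : {A : Finset (Fin r) // A ⊆ X},
          g i A.1 = MvPolynomial.eval (fun _ => 1) (Φ A (Sum.inl i))) ∧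
        ∀ A : Finset (Fin r), ¬ A ⊆ X → g i A = 0

/-- The complex `V ⊕ ⨁_{1 ≠ v ≤ u} E v`. -/
def sumBelow {m : Fin r → (Fin n →₀ ℕ)} (u : LcmLattice m) (V : BasedComplex k)
    (E : LcmLattice m → BasedComplex k) : BasedComplex k :=
  V.sum (BasedComplex.directSum fun v : LcmBelow u => E v.1)

/-- The chains corresponding to the basis elements of `V ⊕ ⨁_{1 ≠ v ≤ u} E v`. -/
def sumBelowChain {m : Fin r → (Fin n →₀ ℕ)} (u : LcmLattice m) {V : BasedComplex k}
    (chainV : V.ι → Chain k r) {E : LcmLattice m → BasedComplex k}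
    (chainE : ∀ v, (E v).ι → Chain k r) : (sumBelow u V E).ι → Chain k r :=
  Sum.elim chainV fun x => chainE x.1.1 x.2

end Monomial

end

noncomputable section

/-! ### Exact closures -/

/-! Filter the chains of the simplex by multidegree, the level of a face being its lcm. The chains
with levels at most `v` form the simplex complex of `Ω_v`, which is acyclic for `v ≠ ⊥`; call it
K(≤v), and let K(<v) be spanned by the faces of smaller level. The heart of the proof is that `Γ v`
represents a basis of the relative homology of (K(≤v), K(<v)):
`TaylorConstruction.isRelativeHomologyBasis`.

Over a field each level splits. Select faces of level `v` whose boundaries are a basis of the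
boundaries modulo K(<v) (`exists_isFaceSelection`). Then relative homology representatives, selected
faces and boundaries of selected faces together form a basis of K(≤v)/K(<v). Collected over a lower
set of levels, these families are triangular, hence a basis of the chains with levels in that set
(`coeff_eq_zero_of_mem_suppOn`, `exists_decomposition`).

For the induction on `v`, this shows that the span of the earlier `Γ w` includes into K(<v) with a
trivial complement, so both have the same homology (`mem_span_add_boundary`). Minimality of the
exact closure forces the differentials of the new basis elements into the old complex
(`BasedComplex.IsExactClosure.D_eq_zero`, by Gaussian elimination); exactness then makes them
represent a basis of the homology of the old complex, that is, of K(<v). As K(≤v) is acyclic, the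
connecting map identifies this with the relative homology.

Taking all levels up to `u` splits K(≤u) as `V u` plus trivial complexes. The change of basis to
faces and its inverse both respect levels (`IsLeveledBasis.exists_matrices`), so it homogenizes to
an isomorphism with the Taylor resolution. Boundaries of elements of `Γ v` have levels below `v`,
which gives minimality; in degree at least 2 the lcm of these levels is exactly `v`, so the
homogenization of the frame uses the levels as multidegrees (`homMdeg_eq_level`). Exactness is
checked in each multigraded strand: a cycle is filled inside a simplex and the filling is projected
to `V u` (`exists_mulVec_eq`). -/

theorem Fintype.sum_subtype_of_forall_not {ι M : Type*} [Fintype ι] [AddCommMonoid M]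
    (p : ι → Prop) [DecidablePred p] (g : ι → M) (h : ∀ i, ¬ p i → g i = 0) :
    ∑ i : {i // p i}, g i.1 = ∑ i, g i := by
  rw [← Finset.sum_subtype (Finset.univ.filter p) (by simp) g]
  refine Finset.sum_subset (Finset.filter_subset _ _) fun i _ hi => h i ?_
  simpa using hi

namespace BasedComplex

variable {R : Type*} [CommRing R]

/-- The component of a vector in homological degree `e`. -/
def degPart (U : BasedComplex R) (e : ℕ) (x : U.ι → R) : U.ι → R :=
  fun j => if U.deg j = e then x j else 0

theorem inDegree_degPart (U : BasedComplex R) (e : ℕ) (x : U.ι → R) :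
    U.InDegree e (U.degPart e x) := by
  intro j hj
  by_contra h
  exact hj (by simp [degPart, h])

theorem degPart_of_inDegree (U : BasedComplex R) {e : ℕ} {x : U.ι → R} (h : U.InDegree e x) :
    U.degPart e x = x := by
  funext j
  unfold degPart
  split_ifs with hj
  · rfl
  · by_contra h0
    exact hj (h j (Ne.symm h0))

theorem mulVec_degPart (U : BasedComplex R) (e : ℕ) (x : U.ι → R) :
    U.D.mulVec (U.degPart (e + 1) x) = U.degPart e (U.D.mulVec x) := by
  funext i
  simp only [degPart, Matrix.mulVec, dotProduct]
  split_ifs with hi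
  · refine Finset.sum_congr rfl fun j _ => ?_
    by_cases hD : U.D i j = 0
    · simp [hD]
    · rw [if_pos (by rw [U.deg_eq i j hD, hi])]
  · refine Finset.sum_eq_zero fun j _ => ?_
    by_cases hD : U.D i j = 0
    · simp [hD]
    · rw [if_neg (by rw [U.deg_eq i j hD]; omega), mul_zero]

theorem mulVec_degPart_zero (U : BasedComplex R) (x : U.ι → R) :
    U.D.mulVec (U.degPart 0 x) = 0 := by
  funext i
  simp only [degPart, Matrix.mulVec, dotProduct, Pi.zero_apply]
  refine Finset.sum_eq_zero fun j _ => ?_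
  by_cases hD : U.D i j = 0
  · simp [hD]
  · rw [if_neg (by rw [U.deg_eq i j hD]; omega), mul_zero]

/-- The differential lowers degree by exactly one, so the homogeneous components of a cycle are
cycles and can be filled separately. This removes degrees from the later exactness arguments. -/
theorem isExact_iff (U : BasedComplex R) :
    U.IsExact ↔ ∀ x, U.D.mulVec x = 0 → ∃ y, U.D.mulVec y = x := by
  constructor
  · intro h x hx
    have h1 : ∀ e, ∃ y, U.InDegree (e + 1) y ∧ U.D.mulVec y = U.degPart e x := by
      intro e
      refine h e _ (U.inDegree_degPart e x) ?_
      rcases e with _ | e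
      · exact U.mulVec_degPart_zero x
      · rw [U.mulVec_degPart, hx]
        funext j
        simp [degPart]
    choose y _ hy using h1
    refine ⟨∑ e ∈ Finset.univ.image U.deg, y e, ?_⟩
    rw [Matrix.mulVec_sum]
    simp only [hy]
    funext j
    rw [Finset.sum_apply]
    simp [degPart]
  · intro h e x hx hx0
    obtain ⟨y, hy⟩ := h x hx0
    exact ⟨U.degPart (e + 1) y, U.inDegree_degPart _ _,
      by rw [U.mulVec_degPart, hy, U.degPart_of_inDegree hx]⟩

variable {k : Type*} [Field k]

theorem D_self (U : BasedComplex R) (i : U.ι) : U.D i i = 0 := by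
  by_contra h
  have := U.deg_eq i i h
  omega

/-- Cancellation of a nonzero entry `D v f` of the differential, extended to the old index
set. -/
def cancelMatrix (V : BasedComplex k) (v f : V.ι) : Matrix V.ι V.ι k :=
  V.D - (V.D v f)⁻¹ • (V.D * Matrix.single f v 1 * V.D)

theorem cancelMatrix_apply (V : BasedComplex k) (v f i j : V.ι) :
    V.cancelMatrix v f i j = V.D i j - (V.D v f)⁻¹ * (V.D i f * V.D v j) := by
  simp [cancelMatrix, Matrix.mul_apply, Matrix.single_apply, ite_and, Finset.sum_ite_eq]

/-- For `V.D v f ≠ 0`, the subtracted multiple of the basis vector at `f` is the one that makes the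
`v`-coordinate of the image vanish. -/
theorem cancelMatrix_mulVec (V : BasedComplex k) (v f : V.ι) (x : V.ι → k) :
    (V.cancelMatrix v f).mulVec x =
      V.D.mulVec (x - Pi.single f ((V.D v f)⁻¹ * V.D.mulVec x v)) := by
  funext i
  rw [Matrix.mulVec_sub]
  simp only [Matrix.mulVec, dotProduct, cancelMatrix_apply, Pi.sub_apply, sub_mul,
    Finset.sum_sub_distrib]
  congr 1
  simp only [Pi.single_apply, mul_ite, mul_zero, Finset.sum_ite_eq', Finset.mem_univ, if_true,
    Finset.mul_sum]
  exact Finset.sum_congr rfl fun j _ => by ring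

theorem cancelMatrix_sq (V : BasedComplex k) (v f : V.ι) :
    V.cancelMatrix v f * V.cancelMatrix v f = 0 := by
  have h := V.sq_zero
  unfold cancelMatrix
  rw [sub_mul, mul_sub, mul_sub, h]
  have h1 : V.D * (V.D v f)⁻¹ • (V.D * Matrix.single f v 1 * V.D) = 0 := by
    rw [Matrix.mul_smul, ← mul_assoc, ← mul_assoc, h]
    simp
  have h2 : (V.D v f)⁻¹ • (V.D * Matrix.single f v 1 * V.D) * V.D = 0 := by
    rw [Matrix.smul_mul, mul_assoc _ V.D V.D, h]
    simp
  have h3 : ((V.D v f)⁻¹ • (V.D * Matrix.single f v 1 * V.D)) *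
      ((V.D v f)⁻¹ • (V.D * Matrix.single f v 1 * V.D)) = 0 := by
    rw [Matrix.smul_mul, Matrix.mul_smul, mul_assoc _ V.D _, ← mul_assoc V.D _ V.D,
      ← mul_assoc V.D V.D _, h]
    simp
  rw [h1, h2, h3]
  simp

/-- Gaussian elimination: the complex obtained by cancelling the basis elements `v` and `f`. -/
def cancel (V : BasedComplex k) (v f : V.ι) (hc : V.D v f ≠ 0) : BasedComplex k where
  ι := {i : V.ι // i ≠ v ∧ i ≠ f}
  deg i := V.deg i.1
  D := Matrix.of fun i j => V.cancelMatrix v f i.1 j.1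
  deg_eq := by
    rintro ⟨i, hi⟩ ⟨j, hj⟩ h
    simp only [Matrix.of_apply, cancelMatrix_apply] at h
    by_cases h1 : V.D i j = 0
    · rw [h1, zero_sub, neg_ne_zero] at h
      have h2 := V.deg_eq i f (left_ne_zero_of_mul (right_ne_zero_of_mul h))
      have h3 := V.deg_eq v j (right_ne_zero_of_mul (right_ne_zero_of_mul h))
      have h4 := V.deg_eq v f hc
      simp only
      omega
    · exact V.deg_eq i j h1
  sq_zero := by
    ext ⟨i, hi⟩ ⟨j, hj⟩
    have h := congrFun (congrFun (V.cancelMatrix_sq v f) i) j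
    rw [Matrix.mul_apply, Matrix.zero_apply] at h ⊢
    rw [← h]
    refine Fintype.sum_subtype_of_forall_not (fun i : V.ι => i ≠ v ∧ i ≠ f)
      (fun t => V.cancelMatrix v f i t * V.cancelMatrix v f t j) ?_
    intro t ht
    -- Row `v` and column `f` of the cancelled matrix are zero, so dropping these two indices does
    -- not change the product.
    have : t = v ∨ t = f := by tauto
    rcases this with rfl | rfl
    · rw [V.cancelMatrix_apply t f t j, mul_comm (V.D t f) (V.D t j)]
      field_simp
      simp
    · rw [V.cancelMatrix_apply v t i t]
      field_simp
      simp

theorem cancel_isExact (V : BasedComplex k) (v f : V.ι) (hc : V.D v f ≠ 0) (hV : V.IsExact) :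
    (V.cancel v f hc).IsExact := by
  rw [isExact_iff] at hV ⊢
  intro x hx
  have hvf : v ≠ f := by
    rintro rfl
    exact hc (V.D_self v)
  have hsum : ∀ z : V.ι → k, (∀ i, ¬ (i ≠ v ∧ i ≠ f) → z i = 0) → ∀ i : (V.cancel v f hc).ι,
      (V.cancel v f hc).D.mulVec (fun j => z j.1) i = (V.cancelMatrix v f).mulVec z i.1 := by
    intro z hz i
    exact Fintype.sum_subtype_of_forall_not (fun i : V.ι => i ≠ v ∧ i ≠ f)
      (fun t => V.cancelMatrix v f i.1 t * z t) fun t ht => by rw [hz t ht, mul_zero]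
  let x' : V.ι → k := fun i => if h : i ≠ v ∧ i ≠ f then x ⟨i, h⟩ else 0
  have hx'0 : ∀ i, ¬ (i ≠ v ∧ i ≠ f) → x' i = 0 := fun i hi => dif_neg hi
  have hx' : ∀ i : (V.cancel v f hc).ι, x' i.1 = x i := fun i => dif_pos i.2
  -- The cycle `x` of the smaller complex is lifted to a cycle `x2` of `V` by adjusting only the
  -- coordinate `f`.
  let x2 := x' - Pi.single f ((V.D v f)⁻¹ * V.D.mulVec x' v)
  have hDx2 : V.D.mulVec x2 = (V.cancelMatrix v f).mulVec x' :=
    (V.cancelMatrix_mulVec v f x').symm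
  have hrow : ∀ i, i ≠ f → V.D.mulVec x2 i = 0 := by
    intro i hi
    by_cases hiv : i = v
    · subst hiv
      have hw : ∀ j, V.cancelMatrix i f i j = 0 := by
        intro j
        rw [V.cancelMatrix_apply]
        field_simp
        simp
      rw [hDx2]
      simp [Matrix.mulVec, dotProduct, hw]
    · rw [hDx2, ← hsum x' hx'0 ⟨i, hiv, hi⟩]
      have : (fun j : (V.cancel v f hc).ι => x' j.1) = x := funext hx'
      rw [this, hx]
      rfl
  have hq : V.D.mulVec x2 = Pi.single f (V.D.mulVec x2 f) := by
    funext i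
    by_cases hi : i = f
    · subst hi; simp
    · rw [hrow i hi, Pi.single_eq_of_ne hi]
  -- The image of `x2` is concentrated at `f`; it is itself a cycle and `V.D v f ≠ 0`, so it
  -- vanishes.
  have hq0 : V.D.mulVec x2 f = 0 := by
    have h1 : V.D.mulVec (V.D.mulVec x2) = 0 := by
      rw [Matrix.mulVec_mulVec, V.sq_zero, Matrix.zero_mulVec]
    rw [hq] at h1
    have h2 := congrFun h1 v
    simp only [Matrix.mulVec_single, Pi.zero_apply] at h2
    simpa [hc] using h2
  have hx20 : V.D.mulVec x2 = 0 := by rw [hq, hq0, Pi.single_zero]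
  obtain ⟨y, hy⟩ := hV x2 hx20
  -- Subtracting a boundary removes the `v`-coordinate of the filling. Its `f`-coordinate can then
  -- simply be dropped, since column `f` of the cancelled matrix is zero.
  let y1 := y - V.D.mulVec (Pi.single f (y v / V.D v f))
  have hDy1 : V.D.mulVec y1 = x2 := by
    simp only [y1]
    rw [Matrix.mulVec_sub, Matrix.mulVec_mulVec, V.sq_zero, Matrix.zero_mulVec, sub_zero, hy]
  have hy1v : y1 v = 0 := by
    simp [y1, Matrix.mulVec_single]
    field_simp
    simp
  let y2 := y1 - Pi.single f (y1 f)
  have hy2 : (V.cancelMatrix v f).mulVec y2 = x2 := by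
    have e1 : (V.cancelMatrix v f).mulVec (Pi.single f (y1 f)) = 0 := by
      funext i
      simp only [Matrix.mulVec_single, Pi.zero_apply, Pi.smul_apply, Matrix.col_apply,
        cancelMatrix_apply]
      field_simp
      simp
    have e2 : x2 v = 0 := by
      simp only [x2, Pi.sub_apply, Pi.single_eq_of_ne hvf, sub_zero]
      exact hx'0 v (by simp)
    simp only [y2]
    rw [Matrix.mulVec_sub, e1, sub_zero, cancelMatrix_mulVec, hDy1, e2]
    simp [hDy1]
  refine ⟨fun j => y2 j.1, ?_⟩
  funext i
  rw [hsum y2, hy2]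
  · simp only [x2, Pi.sub_apply, Pi.single_eq_of_ne i.2.2, sub_zero]
    exact hx' i
  · intro j hj
    have : j = v ∨ j = f := by tauto
    rcases this with rfl | rfl
    · simp [y2, hy1v, Pi.single_eq_of_ne hvf]
    · simp [y2]

/-- The differential of an exact closure takes the new basis elements into the given complex. -/
theorem IsExactClosure.D_eq_zero {U V : BasedComplex k} {φ : U.ι → V.ι}
    (h : IsExactClosure U V φ) {v f : V.ι} (hv : v ∉ Set.range φ) (hf : f ∉ Set.range φ) :
    V.D v f = 0 := by
  by_contra hc
  have hne : ∀ i, φ i ≠ v ∧ φ i ≠ f := fun i =>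
    ⟨fun e => hv ⟨i, e⟩, fun e => hf ⟨i, e⟩⟩
  have hlt : Fintype.card (V.cancel v f hc).ι < Fintype.card V.ι :=
    Fintype.card_subtype_lt (p := fun i : V.ι => i ≠ v ∧ i ≠ f) (x := v) (by simp)
  -- Cancelling two new basis elements would give a smaller exact complex. It still contains `U`: by
  -- `stable` the entries of row `v` over `U` are zero, so the correction term vanishes on the
  -- columns of `U`.
  refine absurd (h.minimal (V.cancel v f hc) (fun i => ⟨φ i, hne i⟩)
    (V.cancel_isExact v f hc h.exact) ⟨?_, ?_, ?_, ?_⟩) (not_le.2 hlt)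
  · intro i j e
    exact h.subcomplex.injective (congrArg Subtype.val e)
  · exact h.subcomplex.deg_eq
  · intro i j
    refine (V.cancelMatrix_apply v f (φ i) (φ j)).trans ?_
    rw [h.subcomplex.stable v hv, h.subcomplex.D_eq]
    simp
  · intro w hw j
    refine (V.cancelMatrix_apply v f w.1 (φ j)).trans ?_
    rw [h.subcomplex.stable v hv, h.subcomplex.stable w.1]
    · simp
    · rintro ⟨i, hi⟩
      exact hw ⟨i, Subtype.ext hi⟩

end BasedComplex

/-! ### The boundary map of the simplex -/

section Boundary

variable {k : Type*} [Field k] {r : ℕ}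

/-- The boundary map as a linear map. -/
def boundaryHom (k : Type*) [Field k] (r : ℕ) : Chain k r →ₗ[k] Chain k r :=
  (boundaryMatrix k r).mulVecLin

theorem boundaryHom_apply (c : Chain k r) : boundaryHom k r c = boundary c := rfl

/-- Indexing the sum by the vertex added to `B`, instead of by the faces containing `B`, makes cone
and support arguments direct. -/
theorem boundary_apply (c : Chain k r) (B : Finset (Fin r)) :
    boundary c B = ∑ v, if v ∈ B then 0 else
      (-1) ^ (B.filter (· < v)).card * c (insert v B) := by
  have h1 : boundary c B = ∑ A, ∑ v, if v ∈ A ∧ B = A.erase v then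
      (-1) ^ (A.filter (· < v)).card * c A else 0 := by
    simp only [boundary, Matrix.mulVec, dotProduct, boundaryMatrix, Finset.sum_mul]
    refine Finset.sum_congr rfl fun A _ => ?_
    rw [← Finset.sum_filter_add_sum_filter_not Finset.univ (· ∈ A)]
    rw [Finset.sum_eq_zero (s := Finset.univ.filter fun x => ¬ x ∈ A)]
    · rw [add_zero]
      refine Finset.sum_congr (by simp) fun v hv => ?_
      simp [(Finset.mem_filter.1 hv).2]
    · intro v hv
      simp only [Finset.mem_filter] at hv
      simp [hv.2]
  rw [h1, Finset.sum_comm]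
  refine Finset.sum_congr rfl fun v _ => ?_
  split_ifs with hv
  · refine Finset.sum_eq_zero fun A _ => if_neg ?_
    rintro ⟨_, rfl⟩
    simp at hv
  · rw [Finset.sum_eq_single (insert v B)]
    · rw [if_pos ⟨Finset.mem_insert_self v B, (Finset.erase_insert hv).symm⟩,
        Finset.filter_insert, if_neg (lt_irrefl v)]
    · intro A _ hA
      refine if_neg ?_
      rintro ⟨h, rfl⟩
      exact hA (Finset.insert_erase h).symm
    · simp

theorem exists_of_boundary_ne_zero {c : Chain k r} {B : Finset (Fin r)} (h : boundary c B ≠ 0) :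
    ∃ v, v ∉ B ∧ c (insert v B) ≠ 0 := by
  rw [boundary_apply] at h
  obtain ⟨v, _, hv⟩ := Finset.exists_ne_zero_of_sum_ne_zero h
  by_cases hB : v ∈ B
  · simp [hB] at hv
  · rw [if_neg hB] at hv
    exact ⟨v, hB, right_ne_zero_of_mul hv⟩

theorem boundary_boundary (c : Chain k r) : boundary (boundary c) = 0 := by
  simp [boundary, Matrix.mulVec_mulVec, boundaryMatrix_sq]

theorem boundaryHom_boundaryHom (c : Chain k r) : boundaryHom k r (boundaryHom k r c) = 0 :=
  boundary_boundary c

theorem chain_eq_sum (c : Chain k r) : c = ∑ A, c A • face k A := by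
  funext B
  simp [face, Finset.sum_apply, Pi.single_apply]

theorem boundary_face_empty : boundary (face k (∅ : Finset (Fin r))) = 0 := by
  funext B
  by_contra h
  obtain ⟨v, _, hv⟩ := exists_of_boundary_ne_zero h
  rw [face, Pi.single_apply, if_neg (Finset.insert_ne_empty v B)] at hv
  exact hv rfl

theorem boundary_face_singleton (i : Fin r) : boundary (face k {i}) = face k ∅ := by
  funext B
  rw [boundary_apply]
  by_cases hB : B = ∅
  · subst hB
    simp [face, Pi.single_apply]
  · rw [show face k ∅ B = 0 from Pi.single_eq_of_ne hB 1]
    refine Finset.sum_eq_zero fun v _ => ?_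
    split_ifs with hv
    · rfl
    · rw [face, Pi.single_apply, if_neg, mul_zero]
      intro h
      obtain ⟨w, hw⟩ := Finset.nonempty_iff_ne_empty.2 hB
      have h1 : v ∈ ({i} : Finset (Fin r)) := h ▸ Finset.mem_insert_self v B
      have h2 : w ∈ ({i} : Finset (Fin r)) := h ▸ Finset.mem_insert_of_mem hw
      rw [Finset.mem_singleton] at h1 h2
      exact hv (h1 ▸ h2 ▸ hw)

/-- The chains all of whose faces lie in `S`. -/
def suppOn (k : Type*) [Field k] {r : ℕ} (S : Set (Finset (Fin r))) :
    Submodule k (Chain k r) where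
  carrier := {c | ∀ A, c A ≠ 0 → A ∈ S}
  zero_mem' A h := absurd rfl h
  add_mem' {c c'} hc hc' A h := by
    by_contra hA
    refine h ?_
    rw [Pi.add_apply, not_not.1 (mt (hc A) hA), not_not.1 (mt (hc' A) hA), add_zero]
  smul_mem' t c hc A h := hc A (right_ne_zero_of_mul (a := t) h)

theorem suppOn_mono {S S' : Set (Finset (Fin r))} (h : S ⊆ S') : suppOn k S ≤ suppOn k S' :=
  fun _ hc A hA => h (hc A hA)

theorem face_mem_suppOn {S : Set (Finset (Fin r))} {A : Finset (Fin r)} (h : A ∈ S) :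
    face k A ∈ suppOn k S := by
  intro B hB
  rw [face, Pi.single_apply] at hB
  by_cases hBA : B = A
  · exact hBA ▸ h
  · simp [hBA] at hB

theorem boundaryHom_mem_suppOn {S : Set (Finset (Fin r))} (hS : IsLowerSet S) {c : Chain k r}
    (hc : c ∈ suppOn k S) : boundaryHom k r c ∈ suppOn k S := by
  intro B hB
  obtain ⟨v, _, hv⟩ := exists_of_boundary_ne_zero (c := c) hB
  exact hS (Finset.subset_insert v B) (hc _ hv)

open Classical in
/-- The part of a chain consisting of the faces in `S`. -/
def restrictTo (S : Set (Finset (Fin r))) (c : Chain k r) : Chain k r :=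
  fun A => if A ∈ S then c A else 0

theorem restrictTo_add_compl (S : Set (Finset (Fin r))) (c : Chain k r) :
    restrictTo S c + restrictTo Sᶜ c = c := by
  funext A
  by_cases h : A ∈ S <;> simp [restrictTo, h]

theorem of_restrictTo_ne_zero {S : Set (Finset (Fin r))} {c : Chain k r} {A : Finset (Fin r)}
    (h : restrictTo S c A ≠ 0) : A ∈ S ∧ c A ≠ 0 := by
  by_cases hA : A ∈ S
  · exact ⟨hA, by simpa [restrictTo, hA] using h⟩
  · simp [restrictTo, hA] at h

theorem restrictTo_apply_of_mem {S : Set (Finset (Fin r))} {c : Chain k r} {A : Finset (Fin r)}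
    (h : A ∈ S) : restrictTo S c A = c A := by
  simp [restrictTo, h]

/-- The cone over a cycle in a nonempty simplex, with the smallest vertex as apex. -/
theorem exists_boundary_eq {X : Finset (Fin r)} (hX : X.Nonempty) {c : Chain k r}
    (hc : c ∈ suppOn k {A | A ⊆ X}) (h0 : boundary c = 0) :
    ∃ z ∈ suppOn k {A | A ⊆ X}, boundary z = c := by
  set i := X.min' hX with hi
  have hiX : i ∈ X := X.min'_mem hX
  -- No vertex of `X` precedes the apex `i`, so removing it always carries the sign `+1`.
  refine ⟨fun B => if i ∈ B then c (B.erase i) else 0, ?_, ?_⟩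
  · intro B hB
    by_cases hiB : i ∈ B
    · simp only [hiB, if_true] at hB
      have := hc _ hB
      intro x hx
      by_cases hxi : x = i
      · exact hxi ▸ hiX
      · exact this (Finset.mem_erase.2 ⟨hxi, hx⟩)
    · simp [hiB] at hB
  · have hsign : ∀ B : Finset (Fin r), B ⊆ X → B.filter (· < i) = ∅ := by
      intro B hB
      refine Finset.filter_eq_empty_iff.2 fun x hx => not_lt.2 (X.min'_le x (hB hx))
    have hcX : ∀ B : Finset (Fin r), c B ≠ 0 → B ⊆ X := fun B h => hc B h
    funext B
    rw [boundary_apply]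
    by_cases hiB : i ∈ B
    -- For faces containing the apex, the cycle equation at `B.erase i` expresses `c B` as minus the
    -- sum over the other vertices.
    · have h1 := congrFun h0 (B.erase i)
      rw [boundary_apply, ← Finset.add_sum_erase _ _ (Finset.mem_univ i)] at h1
      simp only [Finset.notMem_erase, if_false, Finset.insert_erase hiB, Pi.zero_apply] at h1
      have h2 : (-1 : k) ^ ((B.erase i).filter (· < i)).card * c B = c B := by
        by_cases hcB : c B = 0
        · simp [hcB]
        · rw [hsign _ ((Finset.erase_subset i B).trans (hcX B hcB))]
          simp
      rw [h2] at h1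
      rw [eq_neg_of_add_eq_zero_left h1, ← Finset.sum_neg_distrib,
        ← Finset.add_sum_erase _ _ (Finset.mem_univ i), if_pos hiB, zero_add]
      refine Finset.sum_congr rfl fun v hv => ?_
      have hvi : v ≠ i := Finset.ne_of_mem_erase hv
      by_cases hvB : v ∈ B
      · simp [hvB, hvi]
      · have hvB' : v ∉ B.erase i := fun h => hvB (Finset.mem_of_mem_erase h)
        rw [if_neg hvB, if_neg hvB', if_pos (Finset.mem_insert_of_mem hiB),
          Finset.erase_insert_of_ne hvi]
        by_cases hcv : c (insert v (B.erase i)) = 0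
        · simp [hcv]
        -- Here `i < v`, so the presence of `i` raises the sign exponent of `v` by one, which
        -- accounts for the minus sign.
        · have hvX : v ∈ X := hcX _ hcv (Finset.mem_insert_self _ _)
          have hlt : i < v := lt_of_le_of_ne (X.min'_le v hvX) (Ne.symm hvi)
          have hmem : i ∈ B.filter (· < v) := Finset.mem_filter.2 ⟨hiB, hlt⟩
          rw [Finset.filter_erase, ← Finset.card_erase_add_one hmem, pow_succ]
          ring
    · rw [Finset.sum_eq_single i]
      · rw [if_neg hiB, if_pos (Finset.mem_insert_self _ _), Finset.erase_insert hiB]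
        by_cases hcB : c B = 0
        · simp [hcB]
        · rw [hsign B (hcX B hcB)]
          simp
      · intro v _ hvi
        split_ifs with hvB h
        · rfl
        · rcases Finset.mem_insert.1 h with h | h
          · exact absurd h.symm hvi
          · exact absurd h hiB
        · simp
      · simp

end Boundary

/-! ### Triangular families of chains -/

section Triangular

variable {k : Type*} [Field k] {r : ℕ} {L : Type} [PartialOrder L]

/-- Chains representing a basis of the homology of the faces of level `v`, relative to the faces of
smaller level. -/
structure IsRelativeHomologyBasis (lv : Finset (Fin r) → L) (v : L) (G : Set (Chain k r)) :
    Prop where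
  mem : ∀ c ∈ G, c ∈ suppOn k (lv ⁻¹' Set.Iic v)
  boundary_mem : ∀ c ∈ G, boundaryHom k r c ∈ suppOn k (lv ⁻¹' Set.Iio v)
  indep : ∀ (ι : Type) [Fintype ι] (g : ι → Chain k r), Function.Injective g → (∀ i, g i ∈ G) →
    ∀ (x : ι → k), ∀ y ∈ suppOn k (lv ⁻¹' Set.Iic v), ∀ z ∈ suppOn k (lv ⁻¹' Set.Iio v),
      ∑ i, x i • g i = boundaryHom k r y + z → ∀ i, x i = 0
  span : ∀ x ∈ suppOn k (lv ⁻¹' Set.Iic v), boundaryHom k r x ∈ suppOn k (lv ⁻¹' Set.Iio v) →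
    ∃ s ∈ Submodule.span k G, ∃ y ∈ suppOn k (lv ⁻¹' Set.Iic v),
      ∃ z ∈ suppOn k (lv ⁻¹' Set.Iio v), x = s + boundaryHom k r y + z

/-- A set `T` of faces such that, for every `v`, the boundaries of the faces in `T` of level `v`
form a basis of the boundaries of the chains of level `v` modulo smaller levels. -/
structure IsFaceSelection (k : Type*) [Field k] (lv : Finset (Fin r) → L)
    (T : Set (Finset (Fin r))) : Prop where
  indep : ∀ v, ∀ a ∈ suppOn k (T ∩ lv ⁻¹' {v}),
    boundaryHom k r a ∈ suppOn k (lv ⁻¹' Set.Iio v) → a = 0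
  span : ∀ v, ∀ x ∈ suppOn k (lv ⁻¹' Set.Iic v),
    ∃ a ∈ suppOn k (T ∩ lv ⁻¹' {v}), boundaryHom k r (x - a) ∈ suppOn k (lv ⁻¹' Set.Iio v)

theorem suppOn_le_span (S : Set (Finset (Fin r))) :
    suppOn k S ≤ Submodule.span k (face k '' S) := by
  intro c hc
  rw [chain_eq_sum c]
  refine Submodule.sum_mem _ fun A _ => ?_
  by_cases hA : c A = 0
  · simp [hA]
  · exact Submodule.smul_mem _ _ (Submodule.subset_span ⟨A, hc A hA, rfl⟩)

variable {lv : Finset (Fin r) → L}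

/-- At each level, extract a maximal linearly independent subfamily from the classes of the
boundaries of the faces of that level, modulo smaller levels; `T` is the union of these choices. -/
theorem exists_isFaceSelection (hlv : Monotone lv) :
    ∃ T : Set (Finset (Fin r)), IsFaceSelection k lv T := by
  have h : ∀ v : L, ∃ T : Set (Finset (Fin r)), T ⊆ lv ⁻¹' {v} ∧
      ((fun A => (suppOn k (lv ⁻¹' Set.Iio v)).mkQ (boundaryHom k r (face k A))) '' (lv ⁻¹' {v}) ⊆
        Submodule.span k
          ((fun A => (suppOn k (lv ⁻¹' Set.Iio v)).mkQ (boundaryHom k r (face k A))) '' T)) ∧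
      LinearIndepOn k
        (fun A => (suppOn k (lv ⁻¹' Set.Iio v)).mkQ (boundaryHom k r (face k A))) T := by
    intro v
    obtain ⟨T, h1, -, h2, h3⟩ := exists_linearIndepOn_extension (linearIndepOn_empty k
      (fun A => (suppOn k (lv ⁻¹' Set.Iio v)).mkQ (boundaryHom k r (face k A))))
      (Set.empty_subset (lv ⁻¹' {v}))
    exact ⟨T, h1, h2, h3⟩
  choose T hT hspan hind using h
  have hTv : ∀ v, (⋃ w, T w) ∩ lv ⁻¹' {v} = T v := by
    intro v
    ext A
    constructor
    · rintro ⟨hA, hv⟩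
      obtain ⟨w, hw⟩ := Set.mem_iUnion.1 hA
      have e1 : lv A = w := hT w hw
      have e2 : lv A = v := hv
      rwa [← e2, e1]
    · exact fun hA => ⟨Set.mem_iUnion.2 ⟨v, hA⟩, hT v hA⟩
  refine ⟨⋃ w, T w, ?_, ?_⟩
  · intro v a ha hb
    rw [hTv] at ha
    have h0 : ∑ A, a A • (suppOn k (lv ⁻¹' Set.Iio v)).mkQ (boundaryHom k r (face k A)) = 0 := by
      rw [chain_eq_sum a, map_sum] at hb
      simp only [map_smul] at hb
      have := (Submodule.Quotient.mk_eq_zero _).2 hb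
      rw [← Submodule.mkQ_apply, map_sum] at this
      simpa only [map_smul] using this
    have h1 := linearIndepOn_iff.1 (hind v) (Finsupp.equivFunOnFinite.symm a)
      ((Finsupp.mem_supported _ _).2 fun A hA => ha A (by simpa using hA)) (by
        rw [Finsupp.linearCombination_apply, Finsupp.sum_fintype _ _ (by simp)]
        exact h0)
    funext A
    exact DFunLike.congr_fun h1 A
  · intro v x hx
    rw [hTv]
    have key : ∀ x ∈ suppOn k (lv ⁻¹' {v}),
        ∃ a ∈ suppOn k (T v), boundaryHom k r (x - a) ∈ suppOn k (lv ⁻¹' Set.Iio v) := by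
      intro x hx
      have h1 : ((suppOn k (lv ⁻¹' Set.Iio v)).mkQ ∘ₗ boundaryHom k r) x ∈ Submodule.map
          ((suppOn k (lv ⁻¹' Set.Iio v)).mkQ ∘ₗ boundaryHom k r)
          (Submodule.span k (face k '' T v)) := by
        have h2 := Submodule.mem_map_of_mem
          (f := (suppOn k (lv ⁻¹' Set.Iio v)).mkQ ∘ₗ boundaryHom k r) (suppOn_le_span _ hx)
        rw [Submodule.map_span, Set.image_image] at h2 ⊢
        exact Submodule.span_le.2 (hspan v) h2
      obtain ⟨a, ha, hxa⟩ := h1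
      refine ⟨a, Submodule.span_le.2 ?_ ha, ?_⟩
      · rintro _ ⟨A, hA, rfl⟩
        exact face_mem_suppOn hA
      · rw [← Submodule.Quotient.mk_eq_zero, ← Submodule.mkQ_apply, map_sub, map_sub, sub_eq_zero]
        exact hxa.symm
    -- Only the part of `x` at level exactly `v` matters: the rest has smaller levels, and so does
    -- its boundary.
    obtain ⟨a, ha, hxa⟩ := key (restrictTo (lv ⁻¹' {v}) x)
      fun A hA => (of_restrictTo_ne_zero hA).1
    refine ⟨a, ha, ?_⟩
    have e : x - a = (restrictTo (lv ⁻¹' {v}) x - a) + restrictTo (lv ⁻¹' {v})ᶜ x := by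
      conv_lhs => rw [← restrictTo_add_compl (lv ⁻¹' {v}) x]
      abel
    rw [e, map_add]
    refine Submodule.add_mem _ hxa (boundaryHom_mem_suppOn
      ((isLowerSet_Iio v).preimage hlv) fun A hA => ?_)
    obtain ⟨h1, h2⟩ := of_restrictTo_ne_zero hA
    exact lt_of_le_of_ne (hx A h2) h1

variable [Finite L] {Γ : L → Set (Chain k r)} {T : Set (Finset (Fin r))} {D : Set L}

/-- The leading terms of a triangular family do not cancel. -/
theorem coeff_eq_zero_of_mem_suppOn (hlv : Monotone lv) (hT : IsFaceSelection k lv T)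
    (hΓ : ∀ v ∈ D, IsRelativeHomologyBasis lv v (Γ v))
    {ι : Type} [Fintype ι] {g : ι → Chain k r} (hg : Function.Injective g)
    (hgΓ : ∀ i, ∃ v ∈ D, g i ∈ Γ v) {x : ι → k} {a b : Chain k r}
    (ha : a ∈ suppOn k (T ∩ lv ⁻¹' D)) (hb : b ∈ suppOn k (T ∩ lv ⁻¹' D))
    {D' : Set L} (hD' : IsLowerSet D')
    (h : ∑ i, x i • g i + a + boundaryHom k r b ∈ suppOn k (lv ⁻¹' D')) :
    (∀ i, ∀ v ∈ D, g i ∈ Γ v → v ∉ D' → x i = 0) ∧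
      a ∈ suppOn k (lv ⁻¹' D') ∧ b ∈ suppOn k (lv ⁻¹' D') := by
  classical
  -- `B` collects the levels outside `D'` at which some coefficient is nonzero; a maximal one is
  -- shown not to exist.
  set B : Set L := {v | v ∈ D ∧ v ∉ D' ∧ ((∃ i, g i ∈ Γ v ∧ x i ≠ 0) ∨
    ∃ A, lv A = v ∧ (a A ≠ 0 ∨ b A ≠ 0))} with hB
  suffices hemp : B = ∅ by
    have hno : ∀ v, v ∉ B := fun v => by rw [hemp]; exact Set.notMem_empty v
    refine ⟨fun i v hv hi hv' => ?_, fun A hA => ?_, fun A hA => ?_⟩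
    · by_contra hx
      exact hno v ⟨hv, hv', Or.inl ⟨i, hi, hx⟩⟩
    · by_contra hA'
      exact hno (lv A) ⟨(ha A hA).2, hA', Or.inr ⟨A, rfl, Or.inl hA⟩⟩
    · by_contra hA'
      exact hno (lv A) ⟨(hb A hA).2, hA', Or.inr ⟨A, rfl, Or.inr hA⟩⟩
  by_contra hne
  obtain ⟨v, ⟨hvD, hvD', hv⟩, hmax⟩ :=
    (Set.toFinite B).exists_maximal (Set.nonempty_iff_ne_empty.2 hne)
  -- By maximality every contribution not at level `v` lies in the lower set `N`, and so does the
  -- total chain. The level-`v` contribution `y` is therefore supported on `N` as well, that is,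
  -- below `v`.
  set N : Set L := {w | ¬ v ≤ w} with hN
  have hNlow : IsLowerSet N := fun w w' hw hw' h => hw' (h.trans hw)
  have hcase : ∀ w ∈ D, w ≠ v → (w ∉ D' → w ∈ B) → w ∈ N := by
    intro w hw hwv hwB hvw
    by_cases hwD' : w ∈ D'
    · exact hvD' (hD' hvw hwD')
    · exact hwv (le_antisymm (hmax (hwB hwD') hvw) hvw)
  have hsub : suppOn k (lv ⁻¹' D') ≤ suppOn k (lv ⁻¹' N) :=
    suppOn_mono fun A hA hv' => hvD' (hD' hv' hA)
  set I := {i : ι // g i ∈ Γ v}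
  have hsplit : ∑ i, x i • g i = ∑ i : I, x i.1 • g i.1 +
      ∑ i : {i : ι // ¬ g i ∈ Γ v}, x i.1 • g i.1 :=
    (Fintype.sum_subtype_add_sum_subtype (fun i => g i ∈ Γ v) fun i => x i • g i).symm
  have hrest1 : ∑ i : {i : ι // ¬ g i ∈ Γ v}, x i.1 • g i.1 ∈ suppOn k (lv ⁻¹' N) := by
    refine Submodule.sum_mem _ fun i _ => ?_
    by_cases hx : x i.1 = 0
    · rw [hx, zero_smul]
      exact Submodule.zero_mem _
    · obtain ⟨w, hw, hiw⟩ := hgΓ i.1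
      have hwv : w ≠ v := fun e => i.2 (e ▸ hiw)
      have hwN := hcase w hw hwv fun hw' => ⟨hw, hw', Or.inl ⟨i.1, hiw, hx⟩⟩
      exact Submodule.smul_mem _ _ (suppOn_mono (fun A hA => hNlow hA hwN)
        ((hΓ w hw).mem _ hiw))
  have hrest2 : ∀ c : Chain k r, (c = a ∨ c = b) →
      restrictTo (lv ⁻¹' {v})ᶜ c ∈ suppOn k (lv ⁻¹' N) := by
    intro c hc A hA
    obtain ⟨h1, h2⟩ := of_restrictTo_ne_zero hA
    have hAD : lv A ∈ D := by
      rcases hc with rfl | rfl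
      · exact (ha A h2).2
      · exact (hb A h2).2
    refine hcase (lv A) hAD h1 fun h3 => ⟨hAD, h3, Or.inr ⟨A, rfl, ?_⟩⟩
    rcases hc with rfl | rfl
    · exact Or.inl h2
    · exact Or.inr h2
  set av := restrictTo (lv ⁻¹' {v}) a with hav
  set bv := restrictTo (lv ⁻¹' {v}) b with hbv
  have havT : av ∈ suppOn k (T ∩ lv ⁻¹' {v}) := fun A hA =>
    ⟨(ha A (of_restrictTo_ne_zero hA).2).1, (of_restrictTo_ne_zero hA).1⟩
  have hbvT : bv ∈ suppOn k (T ∩ lv ⁻¹' {v}) := fun A hA =>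
    ⟨(hb A (of_restrictTo_ne_zero hA).2).1, (of_restrictTo_ne_zero hA).1⟩
  have hle : suppOn k (T ∩ lv ⁻¹' {v}) ≤ suppOn k (lv ⁻¹' Set.Iic v) :=
    suppOn_mono fun A hA => le_of_eq hA.2
  have hIic : IsLowerSet (lv ⁻¹' Set.Iic v) := (isLowerSet_Iic v).preimage hlv
  have hIio : IsLowerSet (lv ⁻¹' Set.Iio v) := (isLowerSet_Iio v).preimage hlv
  set y := ∑ i : I, x i.1 • g i.1 + av + boundaryHom k r bv with hy
  have hyle : y ∈ suppOn k (lv ⁻¹' Set.Iic v) := by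
    refine Submodule.add_mem _ (Submodule.add_mem _ (Submodule.sum_mem _ fun i _ =>
      Submodule.smul_mem _ _ ((hΓ v hvD).mem _ i.2)) (hle havT)) ?_
    exact boundaryHom_mem_suppOn hIic (hle hbvT)
  have hyN : y ∈ suppOn k (lv ⁻¹' N) := by
    have e : y = (∑ i, x i • g i + a + boundaryHom k r b) -
        ∑ i : {i : ι // ¬ g i ∈ Γ v}, x i.1 • g i.1 - restrictTo (lv ⁻¹' {v})ᶜ a -
        boundaryHom k r (restrictTo (lv ⁻¹' {v})ᶜ b) := by
      have ea : av = a - restrictTo (lv ⁻¹' {v})ᶜ a :=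
        eq_sub_of_add_eq (restrictTo_add_compl _ a)
      have eb : bv = b - restrictTo (lv ⁻¹' {v})ᶜ b :=
        eq_sub_of_add_eq (restrictTo_add_compl _ b)
      rw [hy, hsplit, ea, eb, map_sub]
      abel
    rw [e]
    exact Submodule.sub_mem _ (Submodule.sub_mem _ (Submodule.sub_mem _ (hsub h) hrest1)
      (hrest2 a (Or.inl rfl)))
      (boundaryHom_mem_suppOn (hNlow.preimage hlv) (hrest2 b (Or.inr rfl)))
  have hylt : y ∈ suppOn k (lv ⁻¹' Set.Iio v) := fun A hA =>
    lt_of_le_of_ne (hyle A hA) fun e => hyN A hA (le_of_eq e.symm)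
  -- Applying the boundary map to `y` kills the `bv` term and leaves `av` up to smaller levels, so
  -- independence of the selection gives `av = 0`. Independence in relative homology then kills the
  -- `x i`, and the selection kills `bv`.
  have hav0 : av = 0 := by
    refine hT.indep v av havT ?_
    have e : boundaryHom k r av = boundaryHom k r y -
        ∑ i : I, x i.1 • boundaryHom k r (g i.1) := by
      rw [hy, map_add, map_add, boundaryHom_boundaryHom, map_sum]
      simp only [map_smul]
      abel
    rw [e]
    exact Submodule.sub_mem _ (boundaryHom_mem_suppOn hIio hylt) (Submodule.sum_mem _ fun i _ =>
      Submodule.smul_mem _ _ ((hΓ v hvD).boundary_mem _ i.2))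
  have hx0 : ∀ i : I, x i.1 = 0 := by
    refine (hΓ v hvD).indep I (fun i => g i.1) (fun i j e => Subtype.ext (hg e)) (fun i => i.2)
      (fun i => x i.1) (-bv) (Submodule.neg_mem _ (hle hbvT)) y hylt ?_
    rw [hy, hav0, map_neg]
    abel
  have hbv0 : bv = 0 := by
    refine hT.indep v bv hbvT ?_
    have e : boundaryHom k r bv = y := by
      rw [hy, hav0, Finset.sum_eq_zero fun i _ => by rw [hx0 i, zero_smul]]
      simp
    rwa [e]
  rcases hv with ⟨i, hi, hxi⟩ | ⟨A, hA, hA' | hA'⟩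
  · exact hxi (hx0 ⟨i, hi⟩)
  · have := congrFun hav0 A
    rw [hav, restrictTo_apply_of_mem (S := lv ⁻¹' {v}) hA] at this
    exact hA' this
  · have := congrFun hbv0 A
    rw [hbv, restrictTo_apply_of_mem (S := lv ⁻¹' {v}) hA] at this
    exact hA' this

/-- Induction on the level: subtracting selected faces turns `x` into a relative cycle, hence into
representatives plus a boundary plus lower terms; the filling of that boundary may again be taken
among selected faces, up to lower terms. -/
theorem exists_decomposition_Iic (hT : IsFaceSelection k lv T)
    (hD : IsLowerSet D) (hΓ : ∀ v ∈ D, IsRelativeHomologyBasis lv v (Γ v)) :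
    ∀ v ∈ D, suppOn k (lv ⁻¹' Set.Iic v) ≤ Submodule.span k (⋃ w ∈ D, Γ w) ⊔
      (suppOn k (T ∩ lv ⁻¹' D) ⊔ (suppOn k (T ∩ lv ⁻¹' D)).map (boundaryHom k r)) := by
  intro v
  induction v using WellFoundedLT.induction with
  | ind v ih =>
  intro hv x hx
  set Y := Submodule.span k (⋃ w ∈ D, Γ w) ⊔
      (suppOn k (T ∩ lv ⁻¹' D) ⊔ (suppOn k (T ∩ lv ⁻¹' D)).map (boundaryHom k r)) with hY
  have hlt : suppOn k (lv ⁻¹' Set.Iio v) ≤ Y := by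
    refine (suppOn_le_span _).trans (Submodule.span_le.2 ?_)
    rintro _ ⟨A, hA, rfl⟩
    exact ih (lv A) hA (hD (le_of_lt hA) hv) (face_mem_suppOn (Set.mem_preimage.2 le_rfl))
  have hTle : suppOn k (T ∩ lv ⁻¹' {v}) ≤ suppOn k (T ∩ lv ⁻¹' D) :=
    suppOn_mono fun A hA => ⟨hA.1, by rwa [Set.mem_preimage, show lv A = v from hA.2]⟩
  have hT1 : suppOn k (T ∩ lv ⁻¹' {v}) ≤ Y :=
    hTle.trans (le_sup_left.trans le_sup_right)
  have hT2 : (suppOn k (T ∩ lv ⁻¹' {v})).map (boundaryHom k r) ≤ Y :=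
    (Submodule.map_mono hTle).trans (le_sup_right.trans le_sup_right)
  obtain ⟨a, ha, hxa⟩ := hT.span v x hx
  have hale : a ∈ suppOn k (lv ⁻¹' Set.Iic v) := suppOn_mono (fun A hA => le_of_eq hA.2) ha
  obtain ⟨s, hs, y, hy, z, hz, e⟩ := (hΓ v hv).span (x - a) (Submodule.sub_mem _ hx hale) hxa
  obtain ⟨b, hb, hyb⟩ := hT.span v y hy
  have e2 : x = a + s + boundaryHom k r b + boundaryHom k r (y - b) + z := by
    rw [map_sub, eq_add_of_sub_eq e]
    abel
  rw [e2]
  refine Submodule.add_mem _ (Submodule.add_mem _ (Submodule.add_mem _ (Submodule.add_mem _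
    (hT1 ha) ?_) (hT2 (Submodule.mem_map_of_mem hb))) (hlt hyb)) (hlt hz)
  exact Submodule.mem_sup_left (Submodule.span_mono (Set.subset_biUnion_of_mem hv) hs)

/-- Every chain with levels in `D` is a combination of the triangular family. -/
theorem exists_decomposition (hT : IsFaceSelection k lv T)
    (hD : IsLowerSet D) (hΓ : ∀ v ∈ D, IsRelativeHomologyBasis lv v (Γ v))
    {c : Chain k r} (hc : c ∈ suppOn k (lv ⁻¹' D)) :
    ∃ s ∈ Submodule.span k (⋃ w ∈ D, Γ w), ∃ a ∈ suppOn k (T ∩ lv ⁻¹' D),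
      ∃ b ∈ suppOn k (T ∩ lv ⁻¹' D), c = s + a + boundaryHom k r b := by
  have h : c ∈ Submodule.span k (⋃ w ∈ D, Γ w) ⊔
      (suppOn k (T ∩ lv ⁻¹' D) ⊔ (suppOn k (T ∩ lv ⁻¹' D)).map (boundaryHom k r)) := by
    refine ((suppOn_le_span _).trans (Submodule.span_le.2 ?_)) hc
    rintro _ ⟨A, hA, rfl⟩
    exact exists_decomposition_Iic hT hD hΓ (lv A) hA
      (face_mem_suppOn (Set.mem_preimage.2 le_rfl))
  obtain ⟨s, hs, t, ht, rfl⟩ := Submodule.mem_sup.1 h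
  obtain ⟨a, ha, _, ⟨b, hb, rfl⟩, rfl⟩ := Submodule.mem_sup.1 ht
  exact ⟨s, hs, a, ha, b, hb, by abel⟩

/-- The complex of chains with levels in `D` is acyclic relative to the span of the `Γ w`. -/
theorem mem_span_add_boundary (hlv : Monotone lv) (hT : IsFaceSelection k lv T)
    (hD : IsLowerSet D) (hΓ : ∀ v ∈ D, IsRelativeHomologyBasis lv v (Γ v))
    {ι : Type} [Fintype ι] {g : ι → Chain k r} (hg : Function.Injective g)
    (hrange : Set.range g = ⋃ w ∈ D, Γ w)
    (hbd : ∀ i, boundaryHom k r (g i) ∈ Submodule.span k (Set.range g))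
    {z : Chain k r} (hz : z ∈ suppOn k (lv ⁻¹' D))
    (hbz : boundaryHom k r z ∈ Submodule.span k (Set.range g)) :
    ∃ s ∈ Submodule.span k (Set.range g), ∃ w ∈ suppOn k (lv ⁻¹' D),
      z = s + boundaryHom k r w := by
  obtain ⟨s, hs, a, ha, b, hb, rfl⟩ := exists_decomposition hT hD hΓ hz
  rw [← hrange] at hs
  have hgΓ : ∀ i, ∃ v ∈ D, g i ∈ Γ v := fun i => by
    have h := Set.mem_range_self (f := g) i
    rw [hrange] at h
    simpa using h
  have hbs : boundaryHom k r s ∈ Submodule.span k (Set.range g) := by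
    have h1 := Submodule.mem_map_of_mem (f := boundaryHom k r) hs
    rw [Submodule.map_span] at h1
    refine Submodule.span_le.2 ?_ h1
    rintro _ ⟨_, ⟨i, rfl⟩, rfl⟩
    exact hbd i
  have hba : boundaryHom k r a ∈ Submodule.span k (Set.range g) := by
    have e : boundaryHom k r a = boundaryHom k r (s + a + boundaryHom k r b) -
        boundaryHom k r s := by
      rw [map_add, map_add, boundaryHom_boundaryHom]
      abel
    rw [e]
    exact Submodule.sub_mem _ hbz hbs
  obtain ⟨x, hx⟩ := (Submodule.mem_span_range_iff_exists_fun k).1 hba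
  -- The boundary of `a` lies in the span of `g`. Read as a relation in the triangular family, with
  -- `-a` as the part under the boundary map and `D' = ∅`, this forces `a = 0`.
  have ha0 : a = 0 := by
    have h0 := (coeff_eq_zero_of_mem_suppOn (D' := ∅) hlv hT hΓ hg hgΓ (x := x)
      (Submodule.zero_mem _) (Submodule.neg_mem _ ha) isLowerSet_empty (by
        rw [hx, map_neg, add_zero, add_neg_cancel]
        exact Submodule.zero_mem _)).2.2
    funext A
    by_contra h
    exact h0 A (neg_ne_zero.2 h)
  exact ⟨s, hs, b, suppOn_mono Set.inter_subset_right hb, by rw [ha0, add_zero]⟩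

end Triangular

/-! ### The sets `Γ v` represent bases of relative homology -/

section LcmLevel

variable {n r : ℕ} {m : Fin r → (Fin n →₀ ℕ)}

/-- The multidegree of a face, as an element of the lcm-lattice. -/
def lcmLevel (m : Fin r → (Fin n →₀ ℕ)) (A : Finset (Fin r)) : LcmLattice m :=
  ⟨A.sup m, A, rfl⟩

theorem lcmLevel_mono (m : Fin r → (Fin n →₀ ℕ)) : Monotone (lcmLevel m) :=
  fun _ _ h => Finset.sup_mono (f := m) h

theorem lcmLevel_surjective (m : Fin r → (Fin n →₀ ℕ)) : Function.Surjective (lcmLevel m) :=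
  fun ⟨_, A, hA⟩ => ⟨A, Subtype.ext hA⟩

theorem mem_label {b : LcmLattice m} {i : Fin r} : i ∈ label (lcmAtom m) b ↔ m i ≤ b.1 := by
  simp only [label, Finset.mem_filter, Finset.mem_univ, true_and]
  rfl

theorem lcmLevel_le_iff {A : Finset (Fin r)} {b : LcmLattice m} :
    lcmLevel m A ≤ b ↔ A ⊆ label (lcmAtom m) b := by
  refine (Finset.sup_le_iff (f := m) (s := A) (a := b.1)).trans ?_
  exact forall₂_congr fun i _ => mem_label.symm

theorem preimage_Iic_eq (b : LcmLattice m) :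
    lcmLevel m ⁻¹' Set.Iic b = {A | A ⊆ label (lcmAtom m) b} :=
  Set.ext fun _ => lcmLevel_le_iff

theorem label_nonempty {b : LcmLattice m} (hb : b ≠ ⊥) : (label (lcmAtom m) b).Nonempty := by
  obtain ⟨A, rfl⟩ := lcmLevel_surjective m b
  rcases A.eq_empty_or_nonempty with rfl | hA
  · exact absurd rfl hb
  · exact hA.mono (lcmLevel_le_iff.1 le_rfl)

variable {k : Type*} [Field k]

/-- A face has level at most `b` exactly when its vertices lie in the label of `b`, so these are the
chains of a full nonempty simplex, which is a cone. -/
theorem exists_boundaryHom_eq {b : LcmLattice m} (hb : b ≠ ⊥) {c : Chain k r}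
    (hc : c ∈ suppOn k (lcmLevel m ⁻¹' Set.Iic b)) (h0 : boundaryHom k r c = 0) :
    ∃ z ∈ suppOn k (lcmLevel m ⁻¹' Set.Iic b), boundaryHom k r z = c := by
  rw [preimage_Iic_eq] at hc ⊢
  exact exists_boundary_eq (label_nonempty hb) hc h0

theorem ne_zero_of_span_ne_top
    (h : Ideal.span (Set.range fun i => monomial (m i) (1 : k)) ≠ ⊤) (i : Fin r) : m i ≠ 0 := by
  intro hi
  refine h ((Ideal.eq_top_iff_one _).2 (Ideal.subset_span ⟨i, ?_⟩))
  simp [hi]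

theorem lcmLevel_eq_bot_iff (hm : ∀ i, m i ≠ 0) {A : Finset (Fin r)} :
    lcmLevel m A = ⊥ ↔ A = ∅ := by
  constructor
  · intro h
    refine Finset.eq_empty_of_forall_notMem fun i hi => hm i ?_
    have h1 : m i ≤ A.sup m := Finset.le_sup hi
    rw [show A.sup m = 0 from congrArg Subtype.val h] at h1
    exact le_antisymm h1 zero_le
  · rintro rfl
    rfl

theorem lcmLevel_singleton (i : Fin r) : lcmLevel m {i} = lcmAtom m i :=
  Subtype.ext Finset.sup_singleton

theorem lcmLevel_le_atom (hmin : ∀ i j, m i ≤ m j → i = j) {A : Finset (Fin r)} {i : Fin r}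
    (h : lcmLevel m A ≤ lcmAtom m i) : A = ∅ ∨ A = {i} := by
  rw [← Finset.subset_singleton_iff]
  intro j hj
  exact Finset.mem_singleton.2 (hmin j i (mem_label.1 (lcmLevel_le_iff.1 h hj)))

end LcmLevel

/-! ### Relative homology along the inductive construction. -/

section Construction

variable {k : Type*} [Field k] {r : ℕ}

theorem sum_extend_smul {ι κ M : Type*} [Fintype ι] [Fintype κ] [AddCommGroup M] [Module k M]
    {f : ι → κ} (hf : Function.Injective f) (x : ι → k) (e : κ → M) :
    ∑ j, Function.extend f x 0 j • e j = ∑ i, x i • e (f i) := by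
  refine (Fintype.sum_of_injective f hf _ _ (fun j hj => ?_) fun i => ?_).symm
  · rw [Function.extend_apply' _ _ _ (by simpa using hj)]
    simp
  · rw [hf.extend_apply]

theorem BasedComplex.IsSubcomplex.mulVec_extend {U V : BasedComplex k} {φ : U.ι → V.ι}
    (h : U.IsSubcomplex V φ) (x : U.ι → k) :
    V.D.mulVec (Function.extend φ x 0) = Function.extend φ (U.D.mulVec x) 0 := by
  funext i
  have e : V.D.mulVec (Function.extend φ x 0) i = ∑ u, x u * V.D i (φ u) := by
    refine Eq.trans ?_ (sum_extend_smul h.injective x (fun j => V.D i j))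
    simp only [Matrix.mulVec, dotProduct, smul_eq_mul, mul_comm]
  rw [e]
  by_cases hi : i ∈ Set.range φ
  · obtain ⟨u, rfl⟩ := hi
    rw [h.injective.extend_apply]
    simp only [h.D_eq, Matrix.mulVec, dotProduct, mul_comm]
  · rw [Function.extend_apply' _ _ _ (by simpa using hi)]
    exact Finset.sum_eq_zero fun u _ => by rw [h.stable i hi, mul_zero]

theorem IsComplexOn.boundaryHom_sum {B : Set (Chain k r)} {U : BasedComplex k}
    {e : U.ι → Chain k r} (h : IsComplexOn B U e) (x : U.ι → k) :
    boundaryHom k r (∑ j, x j • e j) = ∑ i, U.D.mulVec x i • e i := by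
  rw [map_sum]
  simp only [map_smul, boundaryHom_apply, h.boundary_eq, Matrix.mulVec, dotProduct,
    Finset.smul_sum, Finset.sum_smul, smul_smul]
  rw [Finset.sum_comm]
  exact Finset.sum_congr rfl fun i _ => Finset.sum_congr rfl fun j _ => by rw [mul_comm]

theorem IsComplexOn.boundaryHom_mem_span {B : Set (Chain k r)} {U : BasedComplex k}
    {e : U.ι → Chain k r} (h : IsComplexOn B U e) (j : U.ι) :
    boundaryHom k r (e j) ∈ Submodule.span k (Set.range e) := by
  rw [boundaryHom_apply, h.boundary_eq]
  exact Submodule.sum_mem _ fun i _ =>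
    Submodule.smul_mem _ _ (Submodule.subset_span ⟨i, rfl⟩)

/-- The hypothesis says that `A₀` is the only face of its level, so the relative complex is
one-dimensional. This covers the bottom element and the atoms. -/
theorem isRelativeHomologyBasis_singleton {L : Type} [PartialOrder L] {lv : Finset (Fin r) → L}
    (hlv : Monotone lv) {A₀ : Finset (Fin r)}
    (h : ∀ A, lv A ≤ lv A₀ → A ≠ A₀ → lv A < lv A₀) :
    IsRelativeHomologyBasis lv (lv A₀) {face k A₀} where
  mem := by
    rintro _ rfl
    exact face_mem_suppOn (Set.mem_preimage.2 le_rfl)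
  boundary_mem := by
    rintro _ rfl B hB
    obtain ⟨a, ha, hne⟩ := exists_of_boundary_ne_zero (c := face k A₀) hB
    have e : insert a B = A₀ := by
      by_contra hA
      exact hne (Pi.single_eq_of_ne hA 1)
    refine h B (hlv (e ▸ Finset.subset_insert a B)) ?_
    rintro rfl
    exact ha (e ▸ Finset.mem_insert_self a B)
  indep := by
    intro ι _ g hg hG x y hy z hz e i
    have hsub : Subsingleton ι := ⟨fun i j => hg ((hG i).trans (hG j).symm)⟩
    have h1 := congrFun e A₀
    rw [Fintype.sum_subsingleton _ i, hG i] at h1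
    have h2 : boundaryHom k r y A₀ = 0 := by
      by_contra hne
      obtain ⟨a, ha, hya⟩ := exists_of_boundary_ne_zero (c := y) hne
      refine (h _ (hy _ hya) ?_).not_ge (hlv (Finset.subset_insert a A₀))
      intro e
      exact ha (e ▸ Finset.mem_insert_self a A₀)
    have h3 : z A₀ = 0 := by
      by_contra hne
      exact lt_irrefl _ (hz A₀ hne)
    rw [Pi.add_apply, h2, h3, Pi.smul_apply] at h1
    simpa [face] using h1
  span := by
    intro x hx _
    refine ⟨x A₀ • face k A₀, Submodule.smul_mem _ _ (Submodule.subset_span rfl), 0,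
      Submodule.zero_mem _, x - x A₀ • face k A₀, ?_, by rw [map_zero]; abel⟩
    intro A hA
    by_cases hAA : A = A₀
    · subst hAA
      exact absurd (by simp [face]) hA
    · refine h A (hx A ?_) hAA
      simpa [face, hAA] using hA

variable {n : ℕ} {m : Fin r → (Fin n →₀ ℕ)}

/-- The new basis elements of an exact closure represent, through their differentials, a basis of
the homology of `U v`. This homology is that of the chains of level below `v`, hence by acyclicity
of the simplex also the relative homology at `v`. -/
theorem TaylorConstruction.isRelativeHomologyBasis_step (C : TaylorConstruction k (lcmAtom m))
    {v : LcmLattice m} (hv : v ≠ ⊥) (hva : v ∉ Set.range (lcmAtom m))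
    (ih : ∀ w ∈ Set.Iio v, IsRelativeHomologyBasis (lcmLevel m) w (C.Γ w)) :
    IsRelativeHomologyBasis (lcmLevel m) v (C.Γ v) := by
  obtain ⟨T, hT⟩ := exists_isFaceSelection (k := k) (lcmLevel_mono m)
  obtain ⟨φ, hcl, hφ, hsupp, hΓ⟩ := C.step v hv hva
  have hU := C.complexU v
  have hV := C.complexV v
  have hrange : Set.range (C.chainU v) = ⋃ w ∈ Set.Iio v, C.Γ w := hU.range_eq
  have hUΓ : ∀ i, ∃ w ∈ Set.Iio v, C.chainU v i ∈ C.Γ w := fun i => by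
    have h := Set.mem_range_self (f := C.chainU v) i
    rw [hrange] at h
    simpa using h
  have hUlt : ∀ i, C.chainU v i ∈ suppOn k (lcmLevel m ⁻¹' Set.Iio v) := by
    intro i
    obtain ⟨w, hw, hi⟩ := hUΓ i
    exact suppOn_mono (Set.preimage_mono (Set.Iic_subset_Iio.2 hw)) ((ih w hw).mem _ hi)
  have hlt_le : suppOn k (lcmLevel m ⁻¹' Set.Iio v) ≤ suppOn k (lcmLevel m ⁻¹' Set.Iic v) :=
    suppOn_mono (Set.preimage_mono Set.Iio_subset_Iic_self)
  have hlin : ∀ x : (C.U v).ι → k, ∑ i, x i • C.chainU v i = 0 → x = 0 := by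
    intro x hx
    have h0 := (coeff_eq_zero_of_mem_suppOn (D' := ∅) (x := x) (a := 0) (b := 0)
      (lcmLevel_mono m) hT ih hU.injective hUΓ (Submodule.zero_mem _) (Submodule.zero_mem _)
      isLowerSet_empty (by rw [hx]; simp)).1
    funext i
    obtain ⟨w, hw, hi⟩ := hUΓ i
    exact h0 i w hw hi (Set.notMem_empty w)
  have hacyc : ∀ z ∈ suppOn k (lcmLevel m ⁻¹' Set.Iio v),
      boundaryHom k r z ∈ Submodule.span k (Set.range (C.chainU v)) →
      ∃ s : (C.U v).ι → k, ∃ w ∈ suppOn k (lcmLevel m ⁻¹' Set.Iio v),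
        z = ∑ i, s i • C.chainU v i + boundaryHom k r w := by
    intro z hz hbz
    obtain ⟨s, hs, w, hw, e⟩ := mem_span_add_boundary (lcmLevel_mono m) hT (isLowerSet_Iio v) ih
      hU.injective hrange hU.boundaryHom_mem_span hz hbz
    obtain ⟨x, rfl⟩ := (Submodule.mem_span_range_iff_exists_fun k).1 hs
    exact ⟨x, w, hw, e⟩
  -- Minimality of the closure enters here: every boundary in `V v` is supported on the old basis
  -- elements.
  have hDV : ∀ (y : (C.V v).ι → k) (i : (C.V v).ι), i ∉ Set.range φ →
      (C.V v).D.mulVec y i = 0 := by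
    intro y i hi
    refine Finset.sum_eq_zero fun j _ => ?_
    by_cases hj : j ∈ Set.range φ
    · obtain ⟨u, rfl⟩ := hj
      simp only [hcl.subcomplex.stable i hi, zero_mul]
    · simp only [hcl.D_eq_zero hi hj, zero_mul]
  have hDVext : ∀ y : (C.V v).ι → k, (C.V v).D.mulVec y =
      Function.extend φ (fun u => (C.V v).D.mulVec y (φ u)) 0 := by
    intro y
    funext i
    by_cases hi : i ∈ Set.range φ
    · obtain ⟨u, rfl⟩ := hi
      rw [hcl.subcomplex.injective.extend_apply]
    · rw [hDV y i hi, Function.extend_apply' _ _ _ (by simpa using hi)]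
      rfl
  have hsumφ : ∀ x : (C.U v).ι → k, ∑ j, Function.extend φ x 0 j • C.chainV v j =
      ∑ i, x i • C.chainU v i := by
    intro x
    rw [sum_extend_smul hcl.subcomplex.injective]
    simp only [hφ]
  have hbV : ∀ y : (C.V v).ι → k, boundaryHom k r (∑ j, y j • C.chainV v j) =
      ∑ u, (C.V v).D.mulVec y (φ u) • C.chainU v u := by
    intro y
    rw [hV.boundaryHom_sum, hDVext y, hsumφ]
    simp only [hcl.subcomplex.injective.extend_apply]
  have hnew : ∀ f, f ∉ Set.range φ → C.chainV v f ∈ suppOn k (lcmLevel m ⁻¹' Set.Iic v) := by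
    intro f hf A hA
    refine lcmLevel_le_iff.2 (Finset.Subset.trans ?_ (hsupp f hf))
    intro i hi
    simp only [chainSupp, Finset.mem_filter, Finset.mem_univ, true_and]
    exact ⟨A, hA, hi⟩
  have hexact := (BasedComplex.isExact_iff _).1 hcl.exact
  refine ⟨?_, ?_, ?_, ?_⟩
  · intro c hc
    rw [hΓ] at hc
    obtain ⟨f, hf, rfl⟩ := hc
    exact hnew f hf
  · intro c hc
    rw [hΓ] at hc
    obtain ⟨f, hf, rfl⟩ := hc
    have h1 := hbV (Pi.single f 1)
    rw [Finset.sum_eq_single f (by intro b _ hb; simp [hb]) (by simp), Pi.single_eq_same,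
      one_smul] at h1
    rw [h1]
    exact Submodule.sum_mem _ fun u _ => Submodule.smul_mem _ _ (hUlt u)
  · intro ι _ g hg hG x y hy z hz e
    have h1 : ∀ i, ∃ f, f ∉ Set.range φ ∧ C.chainV v f = g i := by
      intro i
      have := hG i
      rw [hΓ] at this
      obtain ⟨f, hf, hfi⟩ := this
      exact ⟨f, hf, hfi⟩
    choose f hf hfg using h1
    have hfinj : Function.Injective f := fun i j hij => hg (by rw [← hfg i, hij, hfg j])
    set X : (C.V v).ι → k := Function.extend f x 0 with hX
    have hXchain : ∑ j, X j • C.chainV v j = ∑ i, x i • g i := by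
      rw [hX, sum_extend_smul hfinj]
      simp only [hfg]
    -- Applying the boundary map to the relation removes the term from `y`, so the boundary of `z`
    -- lies in the span of the old chains; `hacyc` then replaces `z` by an old chain up to a
    -- boundary.
    have h2 : boundaryHom k r z = ∑ u, (C.V v).D.mulVec X (φ u) • C.chainU v u := by
      rw [← hbV, hXchain, e, map_add, boundaryHom_boundaryHom, zero_add]
    obtain ⟨s, w, hw, hzs⟩ := hacyc z hz (by
      rw [h2]
      exact Submodule.sum_mem _ fun i _ =>
        Submodule.smul_mem _ _ (Submodule.subset_span ⟨i, rfl⟩))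
    rw [hzs, map_add, boundaryHom_boundaryHom, add_zero, hU.boundaryHom_sum] at h2
    have h3 : (fun u => (C.V v).D.mulVec X (φ u)) = (C.U v).D.mulVec s := by
      have := hlin ((C.U v).D.mulVec s - fun u => (C.V v).D.mulVec X (φ u)) (by
        simp only [Pi.sub_apply, sub_smul, Finset.sum_sub_distrib]
        rw [h2, sub_self])
      exact (sub_eq_zero.1 this).symm
    -- The new coefficients minus those of `s` form a cycle of `V v`, hence a boundary, whose new
    -- coordinates vanish; these coordinates are the original `x i`.
    have h4 : (C.V v).D.mulVec (X - Function.extend φ s 0) = 0 := by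
      rw [Matrix.mulVec_sub, hcl.subcomplex.mulVec_extend, hDVext X, h3, sub_self]
    obtain ⟨Y, hY⟩ := hexact _ h4
    intro i
    have h5 := congrFun hY (f i)
    rw [hDV Y _ (hf i), Pi.sub_apply, hX, hfinj.extend_apply,
      Function.extend_apply' _ _ _ (by simpa using hf i)] at h5
    simpa using h5.symm
  · intro x hx hbx
    -- For spanning, the boundary of `x` is a cycle below `v`, so it is homologous to an old cycle
    -- `s`. Exactness fills `s` in `V v`, and `x` minus this filling and `w` is a cycle of the full
    -- simplex.
    obtain ⟨s, w, hw, hzs⟩ := hacyc (boundaryHom k r x) hbx (by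
      rw [boundaryHom_boundaryHom]
      exact Submodule.zero_mem _)
    have h1 : (C.U v).D.mulVec s = 0 := by
      refine hlin _ ?_
      rw [← hU.boundaryHom_sum, eq_sub_of_add_eq hzs.symm, map_sub, boundaryHom_boundaryHom,
        boundaryHom_boundaryHom, sub_zero]
    have h2 : (C.V v).D.mulVec (Function.extend φ s 0) = 0 := by
      rw [hcl.subcomplex.mulVec_extend, h1]
      funext i
      by_cases hi : i ∈ Set.range φ
      · obtain ⟨u, rfl⟩ := hi
        rw [hcl.subcomplex.injective.extend_apply]
        rfl
      · rw [Function.extend_apply' _ _ _ (by simpa using hi)]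
    obtain ⟨Y, hY⟩ := hexact _ h2
    have h3 : ∑ j, Y j • C.chainV v j ∈
        Submodule.span k (C.Γ v) ⊔ suppOn k (lcmLevel m ⁻¹' Set.Iio v) := by
      refine Submodule.sum_mem _ fun j _ => Submodule.smul_mem _ _ ?_
      by_cases hj : j ∈ Set.range φ
      · obtain ⟨u, rfl⟩ := hj
        rw [hφ]
        exact Submodule.mem_sup_right (hUlt u)
      · refine Submodule.mem_sup_left (Submodule.subset_span ?_)
        rw [hΓ]
        exact ⟨j, hj, rfl⟩
    have h4 : ∑ j, Y j • C.chainV v j ∈ suppOn k (lcmLevel m ⁻¹' Set.Iic v) := by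
      refine Submodule.sum_mem _ fun j _ => Submodule.smul_mem _ _ ?_
      by_cases hj : j ∈ Set.range φ
      · obtain ⟨u, rfl⟩ := hj
        rw [hφ]
        exact hlt_le (hUlt u)
      · exact hnew j hj
    have h5 : boundaryHom k r (∑ j, Y j • C.chainV v j) = ∑ i, s i • C.chainU v i := by
      rw [hV.boundaryHom_sum, hY, hsumφ]
    obtain ⟨y, hy, hyx⟩ := exists_boundaryHom_eq hv
      (Submodule.sub_mem _ (Submodule.sub_mem _ hx h4) (hlt_le hw)) (by
        rw [map_sub, map_sub, h5, hzs]
        abel)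
    obtain ⟨γ, hγ, u', hu', e⟩ := Submodule.mem_sup.1 h3
    refine ⟨γ, hγ, y, hy, u' + w, Submodule.add_mem _ hu' hw, ?_⟩
    rw [hyx, ← e]
    abel

/-- Nontriviality of the monomials makes the empty face the only one at the bottom, and minimality
of the generators leaves only the vertex itself at an atom. -/
theorem TaylorConstruction.isRelativeHomologyBasis (C : TaylorConstruction k (lcmAtom m))
    (hmin : ∀ i j, m i ≤ m j → i = j) (hm : ∀ i, m i ≠ 0) (v : LcmLattice m) :
    IsRelativeHomologyBasis (lcmLevel m) v (C.Γ v) := by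
  induction v using WellFoundedLT.induction with
  | ind v ih =>
  by_cases hv : v = ⊥
  · subst hv
    rw [C.Γ_bot]
    refine isRelativeHomologyBasis_singleton (lcmLevel_mono m) (A₀ := ∅) fun A hA hne => ?_
    exact absurd ((lcmLevel_eq_bot_iff hm).1 (le_bot_iff.1 hA)) hne
  by_cases hva : v ∈ Set.range (lcmAtom m)
  · obtain ⟨i, rfl⟩ := hva
    rw [C.Γ_atom, ← lcmLevel_singleton]
    refine isRelativeHomologyBasis_singleton (lcmLevel_mono m) fun A hA hne => ?_
    rw [lcmLevel_singleton] at hA ⊢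
    rcases lcmLevel_le_atom hmin hA with rfl | rfl
    · exact bot_lt_iff_ne_bot.2 hv
    · exact absurd rfl hne
  · exact C.isRelativeHomologyBasis_step hv hva fun w hw => ih w hw

end Construction

/-! ### Homogenization -/

section Homogenization

variable {k : Type*} [Field k] {n : ℕ}

/-- The matrix over `S` obtained from a matrix over `k` by multigrading rows and columns. -/
def homMatrix {ι κ : Type*} (ν : ι → (Fin n →₀ ℕ)) (μ : κ → (Fin n →₀ ℕ)) (Φ : Matrix ι κ k) :
    Matrix ι κ (MvPolynomial (Fin n) k) :=
  Matrix.of fun i j => monomial (μ j - ν i) (Φ i j)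

theorem homMatrix_apply {ι κ : Type*} (ν : ι → (Fin n →₀ ℕ)) (μ : κ → (Fin n →₀ ℕ))
    (Φ : Matrix ι κ k) (i : ι) (j : κ) :
    homMatrix ν μ Φ i j = monomial (μ j - ν i) (Φ i j) := rfl

theorem homMatrix_mul {ι κ l : Type*} [Fintype κ] {ν : ι → (Fin n →₀ ℕ)}
    {μ : κ → (Fin n →₀ ℕ)} {ρ : l → (Fin n →₀ ℕ)} {Φ : Matrix ι κ k} {Ψ : Matrix κ l k}
    (hΦ : ∀ i j, Φ i j ≠ 0 → ν i ≤ μ j) (hΨ : ∀ i j, Ψ i j ≠ 0 → μ i ≤ ρ j) :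
    homMatrix ν μ Φ * homMatrix μ ρ Ψ = homMatrix ν ρ (Φ * Ψ) := by
  ext1 i j
  rw [Matrix.mul_apply, homMatrix_apply, Matrix.mul_apply, map_sum]
  refine Finset.sum_congr rfl fun t _ => ?_
  rw [homMatrix_apply, homMatrix_apply, monomial_mul]
  by_cases h1 : Φ i t = 0
  · simp [h1]
  by_cases h2 : Ψ t j = 0
  · simp [h2]
  rw [add_comm, tsub_add_tsub_cancel (hΨ t j h2) (hΦ i t h1)]

theorem homMatrix_one {ι : Type*} [DecidableEq ι] (ν : ι → (Fin n →₀ ℕ)) :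
    homMatrix ν ν (1 : Matrix ι ι k) = 1 := by
  ext1 i j
  rw [homMatrix_apply]
  by_cases h : i = j
  · subst h
    simp
  · simp [h]

/-- An isomorphism over `k` that respects the multidegrees in both directions homogenizes to an
isomorphism of multigraded complexes. -/
theorem MultigradedComplex.isIso_homMatrix {F G : MultigradedComplex k n}
    {DF : Matrix F.ι F.ι k} {DG : Matrix G.ι G.ι k}
    (hF : F.D = homMatrix F.mdeg F.mdeg DF) (hG : G.D = homMatrix G.mdeg G.mdeg DG)
    (hDF : ∀ i j, DF i j ≠ 0 → F.mdeg i ≤ F.mdeg j)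
    (hDG : ∀ i j, DG i j ≠ 0 → G.mdeg i ≤ G.mdeg j)
    {Φ : Matrix G.ι F.ι k} {Ψ : Matrix F.ι G.ι k}
    (hΦ : ∀ i j, Φ i j ≠ 0 → G.mdeg i ≤ F.mdeg j) (hΨ : ∀ i j, Ψ i j ≠ 0 → F.mdeg i ≤ G.mdeg j)
    (h1 : Ψ * Φ = 1) (h2 : Φ * Ψ = 1) (hcomm : Φ * DF = DG * Φ)
    (hdeg : ∀ i j, Φ i j ≠ 0 → G.deg i = F.deg j) :
    F.IsIso G (homMatrix G.mdeg F.mdeg Φ) := by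
  have hne : ∀ i j, homMatrix G.mdeg F.mdeg Φ i j ≠ 0 → Φ i j ≠ 0 := fun i j h h0 =>
    h (by rw [homMatrix_apply, h0, map_zero])
  refine ⟨⟨fun i j h => hdeg i j (hne i j h), ⟨homMatrix F.mdeg G.mdeg Ψ, ?_, ?_⟩, ?_⟩,
    fun i j h => ⟨hΦ i j (hne i j h), Φ i j, rfl⟩⟩
  · rw [homMatrix_mul hΨ hΦ, h1, homMatrix_one]
  · rw [homMatrix_mul hΦ hΨ, h2, homMatrix_one]
  · rw [hF, hG, homMatrix_mul hΦ hDF, homMatrix_mul hDG hΦ, hcomm]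

namespace BasedComplex

/-- The strand of a vector over `S` in multidegree `a`. -/
def strand {ι : Type*} (μ : ι → (Fin n →₀ ℕ)) (a : Fin n →₀ ℕ)
    (x : ι → MvPolynomial (Fin n) k) : ι → k :=
  fun j => if μ j ≤ a then coeff (a - μ j) (x j) else 0

/-- The vector over `S` that is homogeneous of multidegree `a` with the given coefficients. -/
def liftStrand {ι : Type*} (μ : ι → (Fin n →₀ ℕ)) (a : Fin n →₀ ℕ) (y : ι → k) :
    ι → MvPolynomial (Fin n) k :=
  fun j => monomial (a - μ j) (y j)

variable (U : BasedComplex k) {μ : U.ι → (Fin n →₀ ℕ)}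
  (hμ : ∀ i j, U.D i j ≠ 0 → μ i ≤ μ j)

theorem mulVec_strand (a : Fin n →₀ ℕ) (x : U.ι → MvPolynomial (Fin n) k) :
    U.D.mulVec (strand μ a x) = strand μ a ((U.homogenizeWith μ hμ).D.mulVec x) := by
  funext i
  unfold strand
  split_ifs with hi
  · change ∑ j, U.D i j * (if μ j ≤ a then coeff (a - μ j) (x j) else 0) =
      coeff (a - μ i) (∑ j, monomial (μ j - μ i) (U.D i j) * x j)
    rw [coeff_sum]
    refine Finset.sum_congr rfl fun j _ => ?_
    rw [coeff_monomial_mul']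
    by_cases hD : U.D i j = 0
    · simp [hD]
    have hij := hμ i j hD
    by_cases hj : μ j ≤ a
    · rw [if_pos hj, if_pos (tsub_le_tsub_right hj _), tsub_tsub_tsub_cancel_right hij]
    · rw [if_neg hj, if_neg, mul_zero]
      intro h
      exact hj ((tsub_le_tsub_iff_right hi).1 h)
  · change ∑ j, U.D i j * (if μ j ≤ a then coeff (a - μ j) (x j) else 0) = 0
    refine Finset.sum_eq_zero fun j _ => ?_
    by_cases hD : U.D i j = 0
    · simp [hD]
    · rw [if_neg fun hj => hi ((hμ i j hD).trans hj), mul_zero]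

theorem mulVec_liftStrand {a : Fin n →₀ ℕ} {y : U.ι → k} (hy : ∀ j, y j ≠ 0 → μ j ≤ a) :
    (U.homogenizeWith μ hμ).D.mulVec (liftStrand μ a y) = liftStrand μ a (U.D.mulVec y) := by
  funext i
  change ∑ j, monomial (μ j - μ i) (U.D i j) * monomial (a - μ j) (y j) =
    monomial (a - μ i) (∑ j, U.D i j * y j)
  rw [map_sum]
  refine Finset.sum_congr rfl fun j _ => ?_
  by_cases hD : U.D i j = 0
  · simp [hD]
  by_cases hyj : y j = 0
  · simp [hyj]
  rw [monomial_mul, add_comm, tsub_add_tsub_cancel (hy j hyj) (hμ i j hD)]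

-- Only the finitely many multidegrees `t + μ j`, with `t` an exponent of `x j`, contribute.
open Classical in
theorem sum_liftStrand_strand {ι : Type*} [Fintype ι] (μ : ι → (Fin n →₀ ℕ))
    (x : ι → MvPolynomial (Fin n) k) :
    ∑ a ∈ Finset.univ.biUnion (fun j => (x j).support.image (· + μ j)),
      liftStrand μ a (strand μ a x) = x := by
  funext j
  ext t
  rw [Finset.sum_apply, coeff_sum]
  have h : ∀ a, coeff t (liftStrand μ a (strand μ a x) j) =
      if a = t + μ j then coeff t (x j) else 0 := by
    intro a
    simp only [liftStrand, strand, coeff_monomial]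
    by_cases ha : μ j ≤ a
    · rw [if_pos ha]
      by_cases e : a - μ j = t
      · rw [if_pos e, if_pos ((tsub_eq_iff_eq_add_of_le ha).1 e), e]
      · rw [if_neg e, if_neg fun e' => e ((tsub_eq_iff_eq_add_of_le ha).2 e')]
    · rw [if_neg ha, if_neg (c := a = t + μ j) fun e => ha (e ▸ le_add_self)]
      simp
  simp only [h]
  rw [Finset.sum_ite_eq']
  split_ifs with hmem
  · rfl
  · by_contra hne
    refine hmem (Finset.mem_biUnion.2 ⟨j, Finset.mem_univ j, Finset.mem_image.2 ⟨t, ?_, rfl⟩⟩)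
    exact mem_support_iff.2 (Ne.symm hne)

/-- A homogenization is exact if all its multigraded strands are. -/
theorem exactAt_homogenizeWith (e : ℕ)
    (h : ∀ (a : Fin n →₀ ℕ) (x : U.ι → k), U.InDegree e x → (∀ j, x j ≠ 0 → μ j ≤ a) →
      U.D.mulVec x = 0 → ∃ y, U.InDegree (e + 1) y ∧ (∀ j, y j ≠ 0 → μ j ≤ a) ∧
        U.D.mulVec y = x) :
    (U.homogenizeWith μ hμ).ExactAt e := by
  classical
  intro (x : U.ι → MvPolynomial (Fin n) k) hx hx0
  have h1 : ∀ a : Fin n →₀ ℕ, ∃ y, U.InDegree (e + 1) y ∧ (∀ j, y j ≠ 0 → μ j ≤ a) ∧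
      U.D.mulVec y = strand μ a x := by
    intro a
    refine h a _ (fun j hj => hx j fun h0 => hj ?_) (fun j hj => ?_) ?_
    · simp [strand, h0]
    · by_contra hja
      exact hj (if_neg hja)
    · refine (mulVec_strand U hμ a x).trans ?_
      rw [hx0]
      exact funext fun i => ite_eq_right_iff.2 fun _ => coeff_zero _
  choose y hy1 hy2 hy3 using h1
  refine ⟨∑ a ∈ Finset.univ.biUnion (fun j => (x j).support.image (· + μ j)),
    liftStrand μ a (y a), ?_, ?_⟩
  · intro j hj
    rw [Finset.sum_apply] at hj
    obtain ⟨a, _, ha⟩ := Finset.exists_ne_zero_of_sum_ne_zero hj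
    exact hy1 a j fun h0 => ha (by simp [liftStrand, h0])
  · rw [Matrix.mulVec_sum]
    refine Eq.trans ?_ (sum_liftStrand_strand μ x)
    refine Finset.sum_congr rfl fun a _ => ?_
    rw [mulVec_liftStrand U hμ (hy2 a), hy3]

variable {U} {J : Type} [Fintype J] {w : J → U.ι} {mm : J → (Fin n →₀ ℕ)}

theorem homMdeg_of_deg_eq_zero {u : U.ι} (hu : U.deg u = 0) : U.homMdeg w mm u = 0 := by
  rw [homMdeg, hu]
  rfl

theorem IsFrame.homMdeg_w (h : U.IsFrame w) (t : J) : U.homMdeg w mm (w t) = mm t := by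
  obtain ⟨o, -, hw, h1, -⟩ := h
  rw [homMdeg, (h1 (w t)).2 ⟨t, rfl⟩, homMdegAux]
  have e : (Finset.univ.filter fun t' => w t' = w t) = {t} := by
    ext t'
    simp [hw.eq_iff]
  convert Finset.sup_singleton (f := mm) (b := t)

/-- The augmentation reads off the coordinate at `o` modulo `M`. Since `o` has multidegree 0 and `w
t` has multidegree `mm t`, the degree-1 differential has image exactly the ideal generated by the
monomials. -/
theorem IsFrame.isFreeResolution (h : U.IsFrame w) {M : Ideal (MvPolynomial (Fin n) k)}
    (hM : M = Ideal.span (Set.range fun t => monomial (mm t) (1 : k)))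
    (hex : ∀ e, 1 ≤ e → (U.homogenization w mm).ExactAt e) :
    (U.homogenization w mm).IsFreeResolution M := by
  refine ⟨hex, ?_⟩
  have h' := h
  obtain ⟨o, h0, hw, h1, hD⟩ := h
  have hbd : ∀ y : U.ι → MvPolynomial (Fin n) k, (U.homogenization w mm).InDegree 1 y →
      (U.homogenization w mm).D.mulVec y o = ∑ t, y (w t) * monomial (mm t) (1 : k) := by
    intro y hy
    symm
    refine Fintype.sum_of_injective w hw _ _ (fun j hj => ?_) fun t => ?_
    · have : y j = 0 := by
        by_contra hne
        exact hj ((h1 j).1 (hy j hne))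
      rw [this, mul_zero]
    · change _ = monomial (U.homMdeg w mm (w t) - U.homMdeg w mm o) (U.D o (w t)) * _
      rw [hD, h'.homMdeg_w, homMdeg_of_deg_eq_zero ((h0 o).2 rfl), tsub_zero, mul_comm]
  refine ⟨(Ideal.Quotient.mkₐ (MvPolynomial (Fin n) k) M).toLinearMap ∘ₗ LinearMap.proj o,
    ?_, ?_, ?_⟩
  · intro (j : U.ι) hj
    obtain rfl := (h0 j).1 hj
    refine ⟨1, ?_⟩
    change Ideal.Quotient.mk M ((Pi.single j 1 : U.ι → MvPolynomial (Fin n) k) j) =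
      Ideal.Quotient.mk M (monomial (U.homMdeg w mm j) 1)
    rw [Pi.single_eq_same, homMdeg_of_deg_eq_zero hj]
    rfl
  · intro q
    obtain ⟨p, rfl⟩ := Ideal.Quotient.mk_surjective q
    refine ⟨(Pi.single o p : U.ι → MvPolynomial (Fin n) k), ?_, ?_⟩
    · intro (j : U.ι) hj
      by_cases hjo : j = o
      · exact (h0 j).2 hjo
      · exact absurd (Pi.single_eq_of_ne (M := fun _ => MvPolynomial (Fin n) k) hjo p) hj
    · change Ideal.Quotient.mk M ((Pi.single o p : U.ι → MvPolynomial (Fin n) k) o) = _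
      rw [Pi.single_eq_same]
  · intro (x : U.ι → MvPolynomial (Fin n) k) hx
    change Ideal.Quotient.mk M (x o) = 0 ↔ _
    rw [Ideal.Quotient.eq_zero_iff_mem, hM, Ideal.mem_span_range_iff_exists_fun]
    constructor
    · rintro ⟨c, hc⟩
      have hy : (U.homogenization w mm).InDegree 1
          (Function.extend w c 0 : U.ι → MvPolynomial (Fin n) k) := by
        intro (j : U.ι) hj
        refine (h1 j).2 ?_
        by_contra hne
        exact hj (Function.extend_apply' _ _ _ hne)
      refine ⟨(Function.extend w c 0 : U.ι → MvPolynomial (Fin n) k), hy, ?_⟩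
      refine funext fun (j : U.ι) => ?_
      by_cases hj : j = o
      · subst hj
        refine (hbd _ hy).trans ?_
        rw [← hc]
        simp only [hw.extend_apply]
      · have hdeg : U.deg j ≠ 0 := fun e => hj ((h0 j).1 e)
        have hxj : x j = 0 := by
          by_contra hne
          exact hdeg (hx j hne)
        rw [hxj]
        refine Finset.sum_eq_zero fun i _ => ?_
        by_contra hne
        have e1 := (U.homogenization w mm).deg_eq j i (left_ne_zero_of_mul hne)
        have e2 := hy i (right_ne_zero_of_mul hne)
        rw [e2] at e1
        exact hdeg (Nat.succ_injective e1.symm)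
    · rintro ⟨y, hy, rfl⟩
      exact ⟨fun t => y (w t), (hbd y hy).symm⟩

end BasedComplex

theorem monomial_mem_span_X {s : Fin n →₀ ℕ} (hs : s ≠ 0) (c : k) :
    monomial s c ∈ Ideal.span (Set.range (X : Fin n → MvPolynomial (Fin n) k)) := by
  rw [← Set.image_univ, mem_ideal_span_X_image]
  intro t ht
  obtain rfl := Finset.mem_singleton.1 (support_monomial_subset ht)
  obtain ⟨i, hi⟩ := Finsupp.ne_iff.1 hs
  exact ⟨i, Set.mem_univ i, hi⟩

end Homogenization

/-! ### Bases of chains adapted to the lcm-lattice -/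

section Leveled

variable {k : Type*} [Field k] {n r : ℕ} {m : Fin r → (Fin n →₀ ℕ)}

/-- All faces of `c` have multidegree at most `v`, and some face has multidegree `v`. -/
def HasLevel (m : Fin r → (Fin n →₀ ℕ)) (c : Chain k r) (v : LcmLattice m) : Prop :=
  c ∈ suppOn k (lcmLevel m ⁻¹' Set.Iic v) ∧ ∃ A, c A ≠ 0 ∧ lcmLevel m A = v

theorem HasLevel.chainMdeg_eq {c : Chain k r} {v : LcmLattice m} (h : HasLevel m c v) :
    chainMdeg m c = v.1 := by
  obtain ⟨h1, A, hA, rfl⟩ := h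
  refine le_antisymm (Finset.sup_le fun B hB => h1 B (by simpa using hB)) ?_
  exact Finset.le_sup (f := fun A : Finset (Fin r) => A.sup m) (by simpa using hA)

/-- The hypothesis says that `v` is the lcm of the vertices in `A`. In this form the lemma applies
both to a single face and to the support of a chain. -/
theorem labelClosure_eq {A : Finset (Fin r)} {v : LcmLattice m}
    (hA : ∀ b, A ⊆ label (lcmAtom m) b ↔ v ≤ b) :
    labelClosure (lcmAtom m) A = label (lcmAtom m) v := by
  ext i
  simp only [labelClosure, Finset.mem_filter, Finset.mem_univ, true_and]
  constructor
  · intro h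
    exact h v ((hA v).2 le_rfl)
  · intro h b hb
    exact mem_label.2 ((mem_label.1 h).trans ((hA b).1 hb))

theorem HasLevel.isTaylorChainAt {c : Chain k r} {v : LcmLattice m} (h : HasLevel m c v) :
    IsTaylorChainAt (lcmAtom m) v c := by
  obtain ⟨h1, A, hA, rfl⟩ := h
  have e1 : labelClosure (lcmAtom m) A = label (lcmAtom m) (lcmLevel m A) :=
    labelClosure_eq fun b => lcmLevel_le_iff.symm
  have e2 : labelClosure (lcmAtom m) (chainSupp c) = label (lcmAtom m) (lcmLevel m A) := by
    refine labelClosure_eq fun b => ⟨fun hb => lcmLevel_le_iff.2 ?_, fun hb i hi => ?_⟩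
    · refine Finset.Subset.trans (fun i hi => ?_) hb
      simp only [chainSupp, Finset.mem_filter, Finset.mem_univ, true_and]
      exact ⟨A, hA, hi⟩
    · simp only [chainSupp, Finset.mem_filter, Finset.mem_univ, true_and] at hi
      obtain ⟨B, hB, hiB⟩ := hi
      exact lcmLevel_le_iff.1 (le_trans (h1 B hB) hb) hiB
  exact ⟨A, hA, e1.trans e2.symm, e2⟩

theorem hasLevel_of_not_mem {c : Chain k r} {v : LcmLattice m}
    (h1 : c ∈ suppOn k (lcmLevel m ⁻¹' Set.Iic v))
    (h2 : c ∉ suppOn k (lcmLevel m ⁻¹' Set.Iio v)) : HasLevel m c v := by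
  refine ⟨h1, ?_⟩
  by_contra hne
  push Not at hne
  exact h2 fun A hA => lt_of_le_of_ne (h1 A hA) (hne A hA)

theorem IsRelativeHomologyBasis.ne_boundary_add {v : LcmLattice m} {G : Set (Chain k r)}
    (h : IsRelativeHomologyBasis (lcmLevel m) v G) {c : Chain k r} (hc : c ∈ G) {y z : Chain k r}
    (hy : y ∈ suppOn k (lcmLevel m ⁻¹' Set.Iic v))
    (hz : z ∈ suppOn k (lcmLevel m ⁻¹' Set.Iio v)) : c ≠ boundaryHom k r y + z := by
  intro e
  exact one_ne_zero (h.indep Unit (fun _ => c) (fun _ _ _ => rfl) (fun _ => hc) (fun _ => 1) y hy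
    z hz (by simpa using e) ())

theorem IsRelativeHomologyBasis.hasLevel {v : LcmLattice m} {G : Set (Chain k r)}
    (h : IsRelativeHomologyBasis (lcmLevel m) v G) {c : Chain k r} (hc : c ∈ G) :
    HasLevel m c v :=
  hasLevel_of_not_mem (h.mem c hc) fun h' =>
    h.ne_boundary_add hc (Submodule.zero_mem _) h' (by simp)

theorem hasLevel_face (A : Finset (Fin r)) : HasLevel m (face k A) (lcmLevel m A) :=
  ⟨face_mem_suppOn (Set.mem_preimage.2 Set.self_mem_Iic), A, by simp [face], rfl⟩

theorem face_ne_zero (A : Finset (Fin r)) : face k A ≠ 0 := by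
  intro h
  have := congrFun h A
  simp [face] at this

variable {T : Set (Finset (Fin r))}

/-- Independence of the selection prevents the boundary from dropping to smaller levels. A selected
face and its boundary thus have the same multidegree, so the entry `1` between them survives
homogenization. -/
theorem IsFaceSelection.hasLevel_boundary (hT : IsFaceSelection k (lcmLevel m) T)
    {A : Finset (Fin r)} (hA : A ∈ T) : HasLevel m (boundary (face k A)) (lcmLevel m A) := by
  refine hasLevel_of_not_mem (boundaryHom_mem_suppOn ((isLowerSet_Iic _).preimage
    (lcmLevel_mono m)) (hasLevel_face A).1) fun h => face_ne_zero (k := k) A ?_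
  exact hT.indep (lcmLevel m A) _ (face_mem_suppOn ⟨hA, rfl⟩) h

theorem IsFaceSelection.empty_notMem (hT : IsFaceSelection k (lcmLevel m) T) : ∅ ∉ T := by
  intro h
  obtain ⟨-, A, hA, -⟩ := hT.hasLevel_boundary h
  exact hA (by rw [boundary_face_empty]; rfl)

/-- A complex of chains whose basis `e` is adapted to the filtration of the chains in the simplex
`Ω_u` by multidegree. -/
structure IsLeveledBasis (m : Fin r → (Fin n →₀ ℕ)) (u : LcmLattice m) (W : BasedComplex k)
    (e : W.ι → Chain k r) (level : W.ι → LcmLattice m) : Prop where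
  hasLevel : ∀ i, HasLevel m (e i) (level i)
  level_le : ∀ i, level i ≤ u
  coeff : ∀ (y : W.ι → k) (D : Set (LcmLattice m)), IsLowerSet D →
    ∑ i, y i • e i ∈ suppOn k (lcmLevel m ⁻¹' D) → ∀ i, y i ≠ 0 → level i ∈ D
  span : ∀ c ∈ suppOn k (lcmLevel m ⁻¹' Set.Iic u), ∃ y : W.ι → k, ∑ i, y i • e i = c
  homogeneous : ∀ i A, e i A ≠ 0 → A.card = W.deg i
  boundary_eq : ∀ j, boundary (e j) = ∑ i, W.D i j • e i

namespace IsLeveledBasis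

variable {u : LcmLattice m} {W : BasedComplex k} {e : W.ι → Chain k r}
  {level : W.ι → LcmLattice m}

theorem linearIndependent (h : IsLeveledBasis m u W e level) : LinearIndependent k e := by
  refine Fintype.linearIndependent_iff.2 fun y hy i => ?_
  by_contra hne
  exact h.coeff y ∅ isLowerSet_empty (by rw [hy]; exact Submodule.zero_mem _) i hne

theorem isComplexOn (h : IsLeveledBasis m u W e level) : IsComplexOn (Set.range e) W e :=
  ⟨h.linearIndependent.injective, rfl, h.homogeneous, h.boundary_eq⟩

theorem level_le_of_D_ne_zero (h : IsLeveledBasis m u W e level) {i j : W.ι}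
    (hD : W.D i j ≠ 0) : level i ≤ level j := by
  refine h.coeff (fun i => W.D i j) (Set.Iic (level j)) (isLowerSet_Iic _) ?_ i hD
  rw [← h.boundary_eq]
  exact boundaryHom_mem_suppOn ((isLowerSet_Iic _).preimage (lcmLevel_mono m)) (h.hasLevel j).1

/-- `Φ` expands the adapted basis in faces and `Ψ` expands faces in the adapted basis. The level
bound for `Ψ`, which comes from `coeff`, is what makes the inverse homogenize as well. -/
theorem exists_matrices (h : IsLeveledBasis m u W e level) :
    ∃ (Φ : Matrix (simplexComplex k (label (lcmAtom m) u)).ι W.ι k)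
    (Ψ : Matrix W.ι (simplexComplex k (label (lcmAtom m) u)).ι k),
    (∀ A i, Φ A i = e i A.1) ∧ Ψ * Φ = 1 ∧ Φ * Ψ = 1 ∧
    Φ * W.D = (simplexComplex k (label (lcmAtom m) u)).D * Φ ∧
    (∀ A i, Φ A i ≠ 0 → A.1.card = W.deg i) ∧
    (∀ A i, Φ A i ≠ 0 → lcmLevel m A.1 ≤ level i) ∧
    ∀ i A, Ψ i A ≠ 0 → level i ≤ lcmLevel m A.1 := by
  set X := label (lcmAtom m) u with hX
  have hface : ∀ A : {A : Finset (Fin r) // A ⊆ X}, ∃ y : W.ι → k,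
      ∑ i, y i • e i = face k A.1 := fun A =>
    h.span _ (face_mem_suppOn (lcmLevel_le_iff.2 A.2))
  choose ψ hψ using hface
  have hsum : ∀ (g : Finset (Fin r) → k) (j : W.ι),
      ∑ A : {A : Finset (Fin r) // A ⊆ X}, g A.1 * e j A.1 = ∑ A, g A * e j A := by
    intro g j
    refine Fintype.sum_subtype_of_forall_not (fun A => A ⊆ X) (fun A => g A * e j A) ?_
    intro A hA
    have : e j A = 0 := by
      by_contra hne
      exact hA (lcmLevel_le_iff.1 (le_trans ((h.hasLevel j).1 A hne) (h.level_le j)))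
    rw [this, mul_zero]
  let Φ : Matrix {A : Finset (Fin r) // A ⊆ X} W.ι k := Matrix.of fun A i => e i A.1
  let Ψ : Matrix W.ι {A : Finset (Fin r) // A ⊆ X} k := Matrix.of fun i A => ψ A i
  have hΦΨ : Φ * Ψ = 1 := by
    ext B A
    have h1 := congrFun (hψ A) B.1
    rw [Finset.sum_apply] at h1
    rw [Matrix.mul_apply, Matrix.one_apply]
    simp only [Φ, Ψ, Matrix.of_apply]
    refine (Finset.sum_congr rfl fun i _ => mul_comm _ _).trans (h1.trans ?_)
    rw [face, Pi.single_apply]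
    simp only [Subtype.ext_iff]
  have hΨΦ : Ψ * Φ = 1 := by
    ext i j
    have h1 : ∑ i, ((Ψ * Φ) i j - (1 : Matrix W.ι W.ι k) i j) • e i = 0 := by
      simp only [sub_smul, Finset.sum_sub_distrib, Matrix.one_apply, ite_smul, one_smul, zero_smul,
        Finset.sum_ite_eq', Finset.mem_univ, if_true]
      rw [sub_eq_zero]
      have e1 : ∀ i, (Ψ * Φ) i j • e i =
          ∑ A : {A : Finset (Fin r) // A ⊆ X}, e j A.1 • ψ A i • e i := by
        intro i
        rw [Matrix.mul_apply, Finset.sum_smul]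
        refine Finset.sum_congr rfl fun A _ => ?_
        rw [smul_smul, mul_comm]
        rfl
      simp only [e1]
      rw [Finset.sum_comm]
      simp only [← Finset.smul_sum, hψ]
      funext B
      rw [Finset.sum_apply]
      have e2 := hsum (fun A => face k A B) j
      simp only [Pi.smul_apply, smul_eq_mul]
      rw [Finset.sum_congr rfl fun A _ => mul_comm _ _, e2]
      simp [face, Pi.single_apply]
    exact sub_eq_zero.1 (Fintype.linearIndependent_iff.1 h.linearIndependent _ h1 i)
  refine ⟨Φ, Ψ, fun _ _ => rfl, hΨΦ, hΦΨ, ?_, fun A i hne => h.homogeneous i A.1 hne,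
    fun A i hne => (h.hasLevel i).1 A.1 hne, fun i A hne => ?_⟩
  · refine Matrix.ext fun (A : {A : Finset (Fin r) // A ⊆ X}) j => ?_
    have h1 := congrFun (h.boundary_eq j) A.1
    rw [Finset.sum_apply] at h1
    refine Eq.trans ?_ (h1.symm.trans (hsum (fun B => boundaryMatrix k r A.1 B) j).symm)
    exact Finset.sum_congr rfl fun i _ => mul_comm _ _
  · refine h.coeff (ψ A) (Set.Iic (lcmLevel m A.1)) (isLowerSet_Iic _) ?_ i hne
    have h1 := (hasLevel_face (k := k) (m := m) A.1).1
    rwa [← hψ A] at h1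

theorem exists_isIso (h : IsLeveledBasis m u W e level) :
    ∃ Φ, W.IsIso (simplexComplex k (label (lcmAtom m) u)) Φ := by
  obtain ⟨Φ, Ψ, -, h1, h2, h3, h4, -, -⟩ := h.exists_matrices
  exact ⟨Φ, h4, ⟨Ψ, h1, h2⟩, h3⟩

theorem exists_homogenizeWith_isIso (h : IsLeveledBasis m u W e level)
    {μ : W.ι → (Fin n →₀ ℕ)} (hμ : ∀ i, μ i = (level i).1)
    (hle : ∀ i j, W.D i j ≠ 0 → μ i ≤ μ j) :
    ∃ Φ : Matrix {A : Finset (Fin r) // A ⊆ label (lcmAtom m) u} W.ι (MvPolynomial (Fin n) k),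
      (W.homogenizeWith μ hle).IsIso (taylorComplex k m (label (lcmAtom m) u)) Φ ∧
      ∀ A i, Φ A i = monomial (μ i - A.1.sup m) (e i A.1) := by
  obtain ⟨Φ, Ψ, h0, h1, h2, h3, h4, h5, h6⟩ := h.exists_matrices
  refine ⟨_, MultigradedComplex.isIso_homMatrix (F := W.homogenizeWith μ hle)
    (G := taylorComplex k m (label (lcmAtom m) u)) (DF := W.D)
    (DG := (simplexComplex k (label (lcmAtom m) u)).D) (Φ := Φ) (Ψ := Ψ) rfl rfl hle ?_ ?_ ?_
    h1 h2 h3 h4, fun A i => ?_⟩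
  · intro B A hne
    obtain ⟨v, _, hB⟩ := boundaryMatrix_ne_zero hne
    exact Finset.sup_mono (hB ▸ Finset.erase_subset v A.1)
  · intro A i hne
    exact le_of_le_of_eq (h5 A i hne) (hμ i).symm
  · intro i A hne
    exact le_of_eq_of_le (hμ i) (h6 i A hne)
  · exact congrArg (monomial (μ i - A.1.sup m)) (h0 A i)

end IsLeveledBasis

end Leveled

/-! ### The complementary trivial complexes -/

section Selection

variable {n r : ℕ} {m : Fin r → (Fin n →₀ ℕ)}

/-- The selected faces of multidegree `v`. -/
abbrev SelectedFace (m : Fin r → (Fin n →₀ ℕ)) (T : Set (Finset (Fin r))) (v : LcmLattice m) :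
    Type :=
  {A : Finset (Fin r) // A ∈ T ∧ lcmLevel m A = v}

instance (T : Set (Finset (Fin r))) (v : LcmLattice m) : Fintype (SelectedFace m T v) :=
  Fintype.ofFinite _

/-- The trivial complex on the selected faces of multidegree `v` and their boundaries. -/
def selectionComplex (k : Type*) [Field k] (m : Fin r → (Fin n →₀ ℕ)) (T : Set (Finset (Fin r)))
    (v : LcmLattice m) : BasedComplex k where
  ι := SelectedFace m T v ⊕ SelectedFace m T v
  -- Writing `card - 1 + 1` makes the degrees differ by one even for the empty face; an actual
  -- selection never contains that face, so the value is then `card`.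
  deg := Sum.elim (fun A => A.1.card - 1 + 1) fun A => A.1.card - 1
  D := Matrix.fromBlocks 0 0 1 0
  deg_eq := by
    rintro (A | A) (B | B) h
    · exact absurd rfl h
    · exact absurd rfl h
    · by_cases hAB : A = B
      · subst hAB
        rfl
      · exact absurd (Matrix.one_apply_ne hAB) h
    · exact absurd rfl h
  sq_zero := by
    rw [Matrix.fromBlocks_multiply]
    simp

variable {k : Type*} [Field k]

theorem selectionComplex_isTrivial (T : Set (Finset (Fin r))) (v : LcmLattice m) :
    (selectionComplex k m T v).IsTrivial := by
  refine ⟨SelectedFace m T v, Equiv.refl _, fun A => Matrix.one_apply_eq A, ?_⟩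
  rintro (A | A) (B | B) h
  · exact absurd rfl h
  · exact absurd rfl h
  · by_cases hAB : A = B
    · subst hAB
      exact ⟨A, rfl, rfl⟩
    · exact absurd (Matrix.one_apply_ne hAB) h
  · exact absurd rfl h

/-- The selected faces and their boundaries, as chains. -/
def selectionChain (k : Type*) [Field k] (m : Fin r → (Fin n →₀ ℕ)) (T : Set (Finset (Fin r)))
    (v : LcmLattice m) : (selectionComplex k m T v).ι → Chain k r :=
  Sum.elim (fun A => face k A.1) fun A => boundary (face k A.1)

variable {T : Set (Finset (Fin r))}

theorem hasLevel_selectionChain (hT : IsFaceSelection k (lcmLevel m) T) (v : LcmLattice m)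
    (i : (selectionComplex k m T v).ι) : HasLevel m (selectionChain k m T v i) v := by
  rcases i with ⟨A, hA, rfl⟩ | ⟨A, hA, rfl⟩
  · exact hasLevel_face A
  · exact hT.hasLevel_boundary hA

theorem selectionChain_homogeneous (hT : IsFaceSelection k (lcmLevel m) T) (v : LcmLattice m)
    (i : (selectionComplex k m T v).ι) (B : Finset (Fin r))
    (h : selectionChain k m T v i B ≠ 0) : B.card = (selectionComplex k m T v).deg i := by
  have hpos : ∀ A : SelectedFace m T v, A.1.card - 1 + 1 = A.1.card := fun A =>
    Nat.sub_add_cancel (Finset.card_pos.2 (Finset.nonempty_iff_ne_empty.2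
      fun e => hT.empty_notMem (e ▸ A.2.1)))
  have hface : ∀ A B : Finset (Fin r), face k A B ≠ 0 → B = A := fun A B h => by
    by_contra hne
    exact h (Pi.single_eq_of_ne hne 1)
  rcases i with A | A
  · exact (congrArg Finset.card (hface A.1 B h)).trans (hpos A).symm
  · obtain ⟨a, ha, hne⟩ := exists_of_boundary_ne_zero (c := face k A.1) h
    have h1 := congrArg Finset.card (hface A.1 _ hne)
    rw [Finset.card_insert_of_notMem ha, ← hpos A] at h1
    exact Nat.succ_injective h1

theorem boundary_selectionChain (T : Set (Finset (Fin r))) (v : LcmLattice m)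
    (j : (selectionComplex k m T v).ι) :
    boundary (selectionChain k m T v j) =
      ∑ i, (selectionComplex k m T v).D i j • selectionChain k m T v i := by
  symm
  refine (Fintype.sum_sum_type _).trans ?_
  rcases j with A | A
  · refine (congrArg₂ (· + ·) (Finset.sum_eq_zero fun B _ => zero_smul k _)
      (Finset.sum_eq_single A (fun B _ hB => ?_) fun h => absurd (Finset.mem_univ A) h)).trans ?_
    · change (1 : Matrix (SelectedFace m T v) (SelectedFace m T v) k) B A • _ = _
      rw [Matrix.one_apply_ne hB, zero_smul]
    · change 0 + (1 : Matrix (SelectedFace m T v) (SelectedFace m T v) k) A A •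
        boundary (face k A.1) = _
      rw [Matrix.one_apply_eq, one_smul, zero_add]
      rfl
  · refine (congrArg₂ (· + ·) (Finset.sum_eq_zero fun B _ => zero_smul k _)
      (Finset.sum_eq_zero fun B _ => zero_smul k _)).trans ?_
    rw [add_zero]
    exact (boundary_boundary _).symm

theorem boundary_sumElim {U V : BasedComplex k} {e : U.ι → Chain k r} {f : V.ι → Chain k r}
    (he : ∀ j, boundary (e j) = ∑ i, U.D i j • e i)
    (hf : ∀ j, boundary (f j) = ∑ i, V.D i j • f i) (j : (U.sum V).ι) :
    boundary (Sum.elim e f j) = ∑ i, (U.sum V).D i j • Sum.elim e f i := by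
  symm
  refine (Fintype.sum_sum_type _).trans ?_
  rcases j with j | j
  · refine (congrArg₂ (· + ·) rfl (Finset.sum_eq_zero fun B _ => zero_smul k _)).trans ?_
    rw [add_zero]
    exact (he j).symm
  · refine (congrArg₂ (· + ·) (Finset.sum_eq_zero fun B _ => zero_smul k _) rfl).trans ?_
    rw [zero_add]
    exact (hf j).symm

theorem boundary_directSum {Q : Type} [Fintype Q] [DecidableEq Q] {E : Q → BasedComplex k}
    {e : ∀ q, (E q).ι → Chain k r}
    (he : ∀ q j, boundary (e q j) = ∑ i, (E q).D i j • e q i) (j : Σ q, (E q).ι) :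
    boundary (e j.1 j.2) = ∑ i : Σ q, (E q).ι, (BasedComplex.directSum E).D i j • e i.1 i.2 := by
  obtain ⟨q, j⟩ := j
  symm
  rw [Fintype.sum_sigma, Finset.sum_eq_single q]
  · rw [he]
    refine Finset.sum_congr rfl fun i _ => ?_
    change Matrix.blockDiagonal' (fun q => (E q).D) ⟨q, i⟩ ⟨q, j⟩ • _ = _
    rw [Matrix.blockDiagonal'_apply_eq]
  · intro p _ hpq
    refine Finset.sum_eq_zero fun i _ => ?_
    change Matrix.blockDiagonal' (fun q => (E q).D) ⟨p, i⟩ ⟨q, j⟩ • _ = _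
    rw [Matrix.blockDiagonal'_apply_ne _ _ _ hpq, zero_smul]
  · simp

end Selection

/-! ### The adapted basis formed by `V u` and the selected faces with their boundaries. -/

section SumBelow

variable {k : Type*} [Field k] {n r : ℕ} {m : Fin r → (Fin n →₀ ℕ)}

namespace TaylorConstruction

variable (C : TaylorConstruction k (lcmAtom m))

theorem exists_mem_Γ (u : LcmLattice m) (j : (C.V u).ι) :
    ∃ v ∈ Set.Iic u, C.chainV u j ∈ C.Γ v := by
  have h := Set.mem_range_self (f := C.chainV u) j
  rw [(C.complexV u).range_eq] at h
  simpa using h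

/-- The element `v` of the lattice such that the basis element lies in `Γ v`. -/
def level (u : LcmLattice m) (j : (C.V u).ι) : LcmLattice m := (C.exists_mem_Γ u j).choose

theorem level_le (u : LcmLattice m) (j : (C.V u).ι) : C.level u j ≤ u :=
  (C.exists_mem_Γ u j).choose_spec.1

theorem mem_Γ_level (u : LcmLattice m) (j : (C.V u).ι) : C.chainV u j ∈ C.Γ (C.level u j) :=
  (C.exists_mem_Γ u j).choose_spec.2

/-- The complex `V_u` together with the complementary trivial complexes. -/
abbrev total (T : Set (Finset (Fin r))) (u : LcmLattice m) : BasedComplex k :=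
  sumBelow u (C.V u) (selectionComplex k m T)

abbrev totalChain (T : Set (Finset (Fin r))) (u : LcmLattice m) :
    (C.total T u).ι → Chain k r :=
  sumBelowChain u (C.chainV u) (selectionChain k m T)

def totalLevel (T : Set (Finset (Fin r))) (u : LcmLattice m) :
    (C.total T u).ι → LcmLattice m :=
  Sum.elim (C.level u) fun x => x.1.1

variable {C} {T : Set (Finset (Fin r))} {u : LcmLattice m}

/-- The face underlying a selected face of arbitrary level. -/
def selectedFace (x : Σ v : LcmBelow u, SelectedFace m T v.1) : Finset (Fin r) := x.2.1

theorem selectedFace_injective :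
    Function.Injective (selectedFace : (Σ v : LcmBelow u, SelectedFace m T v.1) → _) := by
  rintro ⟨⟨v, hv⟩, A, hA, hAv⟩ ⟨⟨w, hw⟩, B, hB, hBw⟩ h
  change A = B at h
  subst h
  dsimp only at hAv hBw
  subst hAv
  subst hBw
  rfl

theorem extend_mem_suppOn (α : (Σ v : LcmBelow u, SelectedFace m T v.1) → k) :
    (Function.extend selectedFace α 0 : Chain k r) ∈
      suppOn k (T ∩ lcmLevel m ⁻¹' Set.Iic u) := by
  intro A hA
  by_cases h : ∃ x : Σ v : LcmBelow u, SelectedFace m T v.1, selectedFace x = A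
  · obtain ⟨⟨v, A, h1, h2⟩, rfl⟩ := h
    exact ⟨h1, le_of_eq_of_le h2 v.2.2⟩
  · exact absurd (Function.extend_apply' _ _ _ h) hA

/-- Omitting level `⊥` from the index set loses nothing: its only face is the empty one, which is
not selected. -/
theorem exists_extend_eq (hm : ∀ i, m i ≠ 0) (hT : IsFaceSelection k (lcmLevel m) T)
    {a : Chain k r} (ha : a ∈ suppOn k (T ∩ lcmLevel m ⁻¹' Set.Iic u)) :
    (Function.extend selectedFace (fun x : Σ v : LcmBelow u, SelectedFace m T v.1 =>
      a (selectedFace x)) 0 : Chain k r) = a := by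
  funext A
  by_cases h : ∃ x : Σ v : LcmBelow u, SelectedFace m T v.1, selectedFace x = A
  · obtain ⟨x, rfl⟩ := h
    rw [selectedFace_injective.extend_apply]
  · rw [Function.extend_apply' _ _ _ h]
    by_contra hne
    obtain ⟨h1, h2⟩ := ha A (Ne.symm hne)
    refine h ⟨⟨⟨lcmLevel m A, fun e => ?_, h2⟩, A, h1, rfl⟩, rfl⟩
    exact hT.empty_notMem ((lcmLevel_eq_bot_iff hm).1 e ▸ h1)

theorem sum_face_eq_extend (α : (Σ v : LcmBelow u, SelectedFace m T v.1) → k) :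
    ∑ x, α x • face k (selectedFace x) = (Function.extend selectedFace α 0 : Chain k r) := by
  rw [chain_eq_sum (Function.extend selectedFace α 0), sum_extend_smul selectedFace_injective]

theorem sum_totalChain (y : (C.total T u).ι → k) :
    ∑ i, y i • C.totalChain T u i = ∑ j, y (Sum.inl j) • C.chainV u j +
      (Function.extend selectedFace (fun x : Σ v : LcmBelow u, SelectedFace m T v.1 =>
        y (Sum.inr ⟨x.1, Sum.inl x.2⟩)) 0 : Chain k r) +
      boundaryHom k r (Function.extend selectedFace
        (fun x : Σ v : LcmBelow u, SelectedFace m T v.1 =>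
          y (Sum.inr ⟨x.1, Sum.inr x.2⟩)) 0 : Chain k r) := by
  refine (Fintype.sum_sum_type _).trans ?_
  rw [add_assoc]
  refine congrArg₂ (· + ·) rfl ?_
  rw [← sum_face_eq_extend, ← sum_face_eq_extend, map_sum, Fintype.sum_sigma, Fintype.sum_sigma,
    ← Finset.sum_add_distrib]
  refine (Fintype.sum_sigma _).trans (Finset.sum_congr rfl fun v _ => ?_)
  refine (Fintype.sum_sum_type _).trans (congrArg₂ (· + ·) rfl ?_)
  refine Finset.sum_congr rfl fun A _ => ?_
  rw [map_smul]
  rfl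

/-- `sum_totalChain` puts a combination into the shape of the triangular family, so `coeff` is the
non-cancellation of leading terms and `span` is the decomposition, both for the lower set of levels
at most `u`. -/
theorem isLeveledBasis (hmin : ∀ i j, m i ≤ m j → i = j) (hm : ∀ i, m i ≠ 0)
    (hT : IsFaceSelection k (lcmLevel m) T) :
    IsLeveledBasis m u (C.total T u) (C.totalChain T u) (C.totalLevel T u) := by
  have hQ := C.isRelativeHomologyBasis hmin hm
  have hV := C.complexV u
  refine ⟨?_, ?_, ?_, ?_, ?_, ?_⟩
  · rintro (j | ⟨v, i⟩)
    · exact (hQ _).hasLevel (C.mem_Γ_level u j)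
    · exact hasLevel_selectionChain hT v.1 i
  · rintro (j | ⟨v, i⟩)
    · exact C.level_le u j
    · exact v.2.2
  · intro y D hD hy
    rw [sum_totalChain] at hy
    obtain ⟨h1, h2, h3⟩ := coeff_eq_zero_of_mem_suppOn (D := Set.Iic u) (lcmLevel_mono m) hT
      (fun v _ => hQ v) hV.injective (C.exists_mem_Γ u) (extend_mem_suppOn _)
      (extend_mem_suppOn _) hD hy
    rintro (j | ⟨v, A | A⟩) hne
    · by_contra hj
      exact hne (h1 j _ (C.level_le u j) (C.mem_Γ_level u j) hj)
    · have := h2 (selectedFace ⟨v, A⟩) (by rwa [selectedFace_injective.extend_apply])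
      rwa [Set.mem_preimage, show lcmLevel m (selectedFace ⟨v, A⟩) = v.1 from A.2.2] at this
    · have := h3 (selectedFace ⟨v, A⟩) (by rwa [selectedFace_injective.extend_apply])
      rwa [Set.mem_preimage, show lcmLevel m (selectedFace ⟨v, A⟩) = v.1 from A.2.2] at this
  · intro c hc
    obtain ⟨s, hs, a, ha, b, hb, rfl⟩ := exists_decomposition hT (isLowerSet_Iic u)
      (fun v _ => hQ v) hc
    have hrange : (⋃ w ∈ Set.Iic u, C.Γ w) = Set.range (C.chainV u) := hV.range_eq.symm
    rw [hrange] at hs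
    obtain ⟨x, rfl⟩ := (Submodule.mem_span_range_iff_exists_fun k).1 hs
    refine ⟨Sum.elim x fun p => Sum.elim (fun A => a A.1) (fun A => b A.1) p.2, ?_⟩
    refine (sum_totalChain _).trans ?_
    exact congrArg₂ (· + ·) (congrArg₂ (· + ·) rfl (exists_extend_eq hm hT ha))
      (congrArg (boundaryHom k r) (exists_extend_eq hm hT hb))
  · rintro (j | ⟨v, i⟩) A hA
    · exact hV.homogeneous j A hA
    · exact selectionChain_homogeneous hT v.1 i A hA
  · exact boundary_sumElim hV.boundary_eq (boundary_directSum
      (E := fun v : LcmBelow u => selectionComplex k m T v.1)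
      (e := fun v => selectionChain k m T v.1) fun v => boundary_selectionChain T v.1)

end TaylorConstruction

end SumBelow

/-! ### The minimal free resolution -/

section Resolution

variable {k : Type*} [Field k] {n r : ℕ} {m : Fin r → (Fin n →₀ ℕ)}

/-- Closure of the lattice under finite lcms lets the joint multidegree of a chain's basis elements
serve again as a level; the empty lcm is `⊥`. -/
theorem exists_lcmLattice_eq_sup {ι : Type*} (s : Finset ι) (f : ι → LcmLattice m) :
    ∃ v : LcmLattice m, v.1 = s.sup fun i => (f i).1 := by
  classical
  induction s using Finset.induction_on with
  | empty => exact ⟨⊥, rfl⟩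
  | insert i s _ ih =>
    obtain ⟨⟨v, A, hA⟩, hv⟩ := ih
    obtain ⟨B, hB⟩ := (f i).2
    refine ⟨⟨_, B ∪ A, rfl⟩, ?_⟩
    rw [Finset.sup_insert, ← hv]
    exact Finset.sup_union.trans (congrArg₂ (· ⊔ ·) hB hA)

namespace TaylorConstruction

variable {C : TaylorConstruction k (lcmAtom m)} {u : LcmLattice m}

theorem linearIndependent_chainV (hmin : ∀ i j, m i ≤ m j → i = j) (hm : ∀ i, m i ≠ 0)
    (u : LcmLattice m) : LinearIndependent k (C.chainV u) := by
  obtain ⟨T, hT⟩ := exists_isFaceSelection (k := k) (lcmLevel_mono m)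
  exact (isLeveledBasis (C := C) (u := u) hmin hm hT).linearIndependent.comp Sum.inl
    Sum.inl_injective

/-- The inequality is strict because elements of `Γ v` are relative cycles; `coeff` transfers this
from chains to matrix entries. It is the source of minimality. -/
theorem level_lt_of_D_ne_zero (hmin : ∀ i j, m i ≤ m j → i = j) (hm : ∀ i, m i ≠ 0)
    {i j : (C.V u).ι} (hD : (C.V u).D i j ≠ 0) : C.level u i < C.level u j := by
  obtain ⟨T, hT⟩ := exists_isFaceSelection (k := k) (lcmLevel_mono m)
  have h := isLeveledBasis (C := C) (u := u) hmin hm hT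
  refine h.coeff (fun i => (C.total T u).D i (Sum.inl j)) (Set.Iio (C.level u j))
    (isLowerSet_Iio _) ?_ (Sum.inl i) hD
  have h1 := (C.isRelativeHomologyBasis hmin hm _).boundary_mem _ (C.mem_Γ_level u j)
  exact (h.boundary_eq (Sum.inl j)) ▸ h1

/-- A single face determines both level and degree, so degrees 0 and 1 force the level to be `⊥` or
an atom, where `Γ` is prescribed. -/
theorem exists_deg_eq_card (hmin : ∀ i j, m i ≤ m j → i = j) (hm : ∀ i, m i ≠ 0)
    (j : (C.V u).ι) : ∃ A, C.chainV u j A ≠ 0 ∧ C.level u j = lcmLevel m A ∧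
      (C.V u).deg j = A.card := by
  obtain ⟨-, A, hA, hl⟩ := (C.isRelativeHomologyBasis hmin hm _).hasLevel (C.mem_Γ_level u j)
  exact ⟨A, hA, hl.symm, ((C.complexV u).homogeneous j A hA).symm⟩

theorem deg_eq_card_of_chainV_eq_face {j : (C.V u).ι} {A : Finset (Fin r)}
    (h : C.chainV u j = face k A) : (C.V u).deg j = A.card :=
  ((C.complexV u).homogeneous j A (by simp [h, face])).symm

theorem deg_eq_zero_iff (hmin : ∀ i j, m i ≤ m j → i = j) (hm : ∀ i, m i ≠ 0)
    {j : (C.V u).ι} : (C.V u).deg j = 0 ↔ C.chainV u j = face k ∅ := by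
  constructor
  · intro h
    obtain ⟨A, -, hl, hd⟩ := C.exists_deg_eq_card hmin hm j
    have hA : A = ∅ := Finset.card_eq_zero.1 (hd.symm.trans h)
    have hj := C.mem_Γ_level u j
    rw [hl, (lcmLevel_eq_bot_iff hm).2 hA, C.Γ_bot] at hj
    exact hj
  · exact deg_eq_card_of_chainV_eq_face

theorem deg_eq_one_iff (hmin : ∀ i j, m i ≤ m j → i = j) (hm : ∀ i, m i ≠ 0)
    {j : (C.V u).ι} : (C.V u).deg j = 1 ↔
      ∃ i ∈ label (lcmAtom m) u, C.chainV u j = face k {i} := by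
  constructor
  · intro h
    obtain ⟨A, -, hl, hd⟩ := C.exists_deg_eq_card hmin hm j
    obtain ⟨i, rfl⟩ := Finset.card_eq_one.1 (hd.symm.trans h)
    have hj := C.mem_Γ_level u j
    rw [hl, lcmLevel_singleton, C.Γ_atom] at hj
    refine ⟨i, ?_, hj⟩
    have := C.level_le u j
    rw [hl] at this
    exact lcmLevel_le_iff.1 this (Finset.mem_singleton_self i)
  · rintro ⟨i, -, h⟩
    exact deg_eq_card_of_chainV_eq_face h

theorem exists_chainV_eq {v : LcmLattice m} (hv : v ≤ u) {c : Chain k r} (hc : c ∈ C.Γ v) :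
    ∃ j, C.chainV u j = c := by
  have h : c ∈ Set.range (C.chainV u) := by
    rw [(C.complexV u).range_eq]
    exact Set.mem_biUnion (show v ∈ Set.Iic u from hv) hc
  exact h

/-- The labelling `τ` allows vertices to be indexed either by the label of `u` or, at the top
element, by `Fin r`. -/
theorem isFrame (hmin : ∀ i j, m i ≤ m j → i = j) (hm : ∀ i, m i ≠ 0) {J : Type}
    {τ : J → Fin r} (hτ : Function.Injective τ)
    (hrange : ∀ i, i ∈ label (lcmAtom m) u ↔ i ∈ Set.range τ) {w : J → (C.V u).ι}
    (hw : ∀ t, C.chainV u (w t) = face k {τ t}) : (C.V u).IsFrame w := by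
  have hinj := (C.complexV u).injective
  obtain ⟨o, ho⟩ := exists_chainV_eq (C := C) (bot_le : ⊥ ≤ u)
    (by rw [C.Γ_bot]; exact Set.mem_singleton _)
  refine ⟨o, fun i => ?_, fun s t h => ?_, fun i => ?_, fun t => ?_⟩
  · rw [deg_eq_zero_iff hmin hm, ← ho, hinj.eq_iff]
  · have h1 : face k {τ s} = face k {τ t} := by rw [← hw, ← hw, h]
    have h2 := congrFun h1 {τ s}
    rw [face, face, Pi.single_eq_same, Pi.single_apply] at h2
    by_cases he : ({τ s} : Finset (Fin r)) = {τ t}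
    · exact hτ (Finset.singleton_injective he)
    · rw [if_neg he] at h2
      exact absurd h2 one_ne_zero
  · rw [deg_eq_one_iff hmin hm]
    constructor
    · rintro ⟨a, ha, hi⟩
      obtain ⟨t, rfl⟩ := (hrange a).1 ha
      exact ⟨t, hinj ((hw t).trans hi.symm)⟩
    · rintro ⟨t, rfl⟩
      exact ⟨τ t, (hrange _).2 ⟨t, rfl⟩, hw t⟩
  · have h1 := (C.complexV u).boundary_eq (w t)
    rw [hw, boundary_face_singleton, ← ho] at h1
    have h2 := Fintype.linearIndependent_iff.1 (linearIndependent_chainV (C := C) hmin hm u)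
      (fun i => (C.V u).D i (w t) - (Pi.single o 1 : (C.V u).ι → k) i) (by
        simp only [sub_smul, Finset.sum_sub_distrib]
        rw [← h1, Finset.sum_eq_single o (by intro b _ hb; simp [hb]) (by simp)]
        simp) o
    rw [Pi.single_eq_same] at h2
    exact sub_eq_zero.1 h2

theorem level_eq_bot_iff (hmin : ∀ i j, m i ≤ m j → i = j) (hm : ∀ i, m i ≠ 0)
    {j : (C.V u).ι} : C.level u j = ⊥ ↔ (C.V u).deg j = 0 := by
  obtain ⟨A, -, hl, hd⟩ := C.exists_deg_eq_card hmin hm j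
  rw [hl, hd, lcmLevel_eq_bot_iff hm, Finset.card_eq_zero]

/-- The multidegrees of the homogenization are the levels. -/
theorem homMdeg_eq_level (hmin : ∀ i j, m i ≤ m j → i = j) (hm : ∀ i, m i ≠ 0) {J : Type}
    [Fintype J] {τ : J → Fin r} (hτ : Function.Injective τ)
    (hrange : ∀ i, i ∈ label (lcmAtom m) u ↔ i ∈ Set.range τ) {w : J → (C.V u).ι}
    (hw : ∀ t, C.chainV u (w t) = face k {τ t}) (j : (C.V u).ι) :
    (C.V u).homMdeg w (fun t => m (τ t)) j = (C.level u j).1 := by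
  classical
  have hQ := C.isRelativeHomologyBasis hmin hm
  suffices h : ∀ e j, (C.V u).deg j = e →
      (C.V u).homMdegAux w (fun t => m (τ t)) e j = (C.level u j).1 from h _ j rfl
  intro e
  induction e with
  | zero =>
    intro j hj
    rw [(level_eq_bot_iff hmin hm).2 hj]
    rfl
  | succ e ih =>
  intro j hj
  rcases e with _ | e
  · have hfr := isFrame hmin hm hτ hrange hw
    obtain ⟨o, -, -, h1, -⟩ := id hfr
    obtain ⟨t, rfl⟩ := (h1 j).1 hj
    have h2 := hfr.homMdeg_w (mm := fun t => m (τ t)) t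
    rw [BasedComplex.homMdeg, hj] at h2
    rw [h2]
    obtain ⟨A, hA, hl, -⟩ := C.exists_deg_eq_card hmin hm (w t)
    rw [hw] at hA
    have : A = {τ t} := by
      by_contra hne
      exact hA (Pi.single_eq_of_ne hne 1)
    rw [hl, this]
    exact (Finset.sup_singleton (f := m)).symm
  · rw [BasedComplex.homMdegAux]
    obtain ⟨v, hv⟩ := exists_lcmLattice_eq_sup
      (Finset.univ.filter fun s => (C.V u).D s j ≠ 0) (C.level u)
    have hdeg : ∀ s, (C.V u).D s j ≠ 0 → (C.V u).deg s = e + 1 := by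
      intro s hs
      have := (C.V u).deg_eq s j hs
      omega
    have hsup : ((Finset.univ.filter fun s => (C.V u).D s j ≠ 0).sup
        ((C.V u).homMdegAux w (fun t => m (τ t)) (e + 1))) = v.1 := by
      rw [hv]
      refine Finset.sup_congr rfl fun s hs => ih s (hdeg s ?_)
      simpa using hs
    refine Eq.trans ?_ (hsup.trans ?_)
    · congr!
    · have hle : v ≤ C.level u j := by
        change v.1 ≤ _
        rw [hv]
        refine Finset.sup_le fun s hs => ?_
        exact (level_lt_of_D_ne_zero hmin hm (by simpa using hs)).le
      have hsv : ∀ s, (C.V u).D s j ≠ 0 → C.level u s ≤ v := by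
        intro s hs
        change (C.level u s).1 ≤ v.1
        rw [hv]
        exact Finset.le_sup (f := fun s => (C.level u s).1) (by simpa using hs)
      -- If `v` were below the level of `j`, the boundary would have a filling `z` of level at most
      -- `v`. The chain minus `z` would be a cycle of the simplex at the level of `j`, hence a
      -- boundary, and the basis element would be zero in relative homology.
      by_contra hne
      have hlt : v < C.level u j := lt_of_le_of_ne hle fun e => hne (congrArg Subtype.val e)
      set c := boundaryHom k r (C.chainV u j) with hc
      have hcsum : c = ∑ s, (C.V u).D s j • C.chainV u s := (C.complexV u).boundary_eq j
      have hcv : c ∈ suppOn k (lcmLevel m ⁻¹' Set.Iic v) := by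
        rw [hcsum]
        refine Submodule.sum_mem _ fun s _ => ?_
        by_cases hs : (C.V u).D s j = 0
        · rw [hs, zero_smul]
          exact Submodule.zero_mem _
        · exact Submodule.smul_mem _ _ (suppOn_mono (Set.preimage_mono
            (Set.Iic_subset_Iic.2 (hsv s hs))) ((hQ _).mem _ (C.mem_Γ_level u s)))
      have hz : ∃ z ∈ suppOn k (lcmLevel m ⁻¹' Set.Iic v), boundaryHom k r z = c := by
        by_cases hvb : v = ⊥
        -- The simplex at `⊥` is not acyclic, but level `⊥` occurs only in degree 0, whereas the
        -- boundary has degree `e + 1`; so it is zero.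
        · refine ⟨0, Submodule.zero_mem _, ?_⟩
          rw [map_zero, hcsum]
          refine (Finset.sum_eq_zero fun s _ => ?_).symm
          by_cases hs : (C.V u).D s j = 0
          · rw [hs, zero_smul]
          · have h1 := (level_eq_bot_iff hmin hm).1
              (le_bot_iff.1 ((hsv s hs).trans (le_of_eq hvb)))
            rw [hdeg s hs] at h1
            exact absurd h1 (Nat.succ_ne_zero e)
        · exact exists_boundaryHom_eq hvb hcv (boundaryHom_boundaryHom _)
      obtain ⟨z, hz, hzc⟩ := hz
      have hjbot : C.level u j ≠ ⊥ := by
        rw [Ne, level_eq_bot_iff hmin hm, hj]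
        exact Nat.succ_ne_zero _
      obtain ⟨y, hy, hyz⟩ := exists_boundaryHom_eq hjbot
        (Submodule.sub_mem _ ((hQ _).mem _ (C.mem_Γ_level u j))
          (suppOn_mono (Set.preimage_mono (Set.Iic_subset_Iic.2 hle)) hz))
        (by rw [map_sub, hzc, sub_self])
      exact (hQ _).ne_boundary_add (C.mem_Γ_level u j) hy
        (suppOn_mono (Set.preimage_mono (Set.Iic_subset_Iio.2 hlt)) hz)
        (by rw [hyz, sub_add_cancel])

/-- The multigraded strands of the homogenization of `V_u` are exact in positive degrees. -/
theorem exists_mulVec_eq (hmin : ∀ i j, m i ≤ m j → i = j) (hm : ∀ i, m i ≠ 0) {e : ℕ}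
    (he : 1 ≤ e) (a : Fin n →₀ ℕ) (x : (C.V u).ι → k) (hx : (C.V u).InDegree e x)
    (hxa : ∀ j, x j ≠ 0 → (C.level u j).1 ≤ a) (h0 : (C.V u).D.mulVec x = 0) :
    ∃ y, (C.V u).InDegree (e + 1) y ∧ (∀ j, y j ≠ 0 → (C.level u j).1 ≤ a) ∧
      (C.V u).D.mulVec y = x := by
  classical
  have hQ := C.isRelativeHomologyBasis hmin hm
  obtain ⟨T, hT⟩ := exists_isFaceSelection (k := k) (lcmLevel_mono m)
  have hW := isLeveledBasis (C := C) (u := u) hmin hm hT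
  -- The bound `a` need not lie in the lattice; the lcm `v` of the levels in `x` does, and it is
  -- below both `a` and `u`.
  obtain ⟨v, hv⟩ := exists_lcmLattice_eq_sup (Finset.univ.filter fun j => x j ≠ 0) (C.level u)
  have hjv : ∀ j, x j ≠ 0 → C.level u j ≤ v := by
    intro j hj
    change (C.level u j).1 ≤ v.1
    rw [hv]
    exact Finset.le_sup (f := fun s => (C.level u s).1) (by simpa using hj)
  have hva : v.1 ≤ a := by
    rw [hv]
    exact Finset.sup_le fun j hj => hxa j (by simpa using hj)
  have hvu : v ≤ u := by
    change v.1 ≤ u.1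
    rw [hv]
    exact Finset.sup_le fun j _ => C.level_le u j
  by_cases hvb : v = ⊥
  · refine ⟨0, fun j hj => absurd rfl hj, fun j hj => absurd rfl hj, ?_⟩
    rw [Matrix.mulVec_zero]
    funext j
    by_contra hne
    have hxj : x j ≠ 0 := Ne.symm hne
    have h1 := (level_eq_bot_iff hmin hm).1
      (le_bot_iff.1 ((hjv j hxj).trans (le_of_eq hvb)))
    have h2 := hx j hxj
    omega
  have hc : ∑ j, x j • C.chainV u j ∈ suppOn k (lcmLevel m ⁻¹' Set.Iic v) := by
    refine Submodule.sum_mem _ fun j _ => ?_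
    by_cases hj : x j = 0
    · rw [hj, zero_smul]
      exact Submodule.zero_mem _
    · exact Submodule.smul_mem _ _ (suppOn_mono (Set.preimage_mono
        (Set.Iic_subset_Iic.2 (hjv j hj))) ((hQ _).mem _ (C.mem_Γ_level u j)))
  obtain ⟨z, hz, hzc⟩ := exists_boundaryHom_eq hvb hc (by
    rw [(C.complexV u).boundaryHom_sum, h0]
    simp)
  obtain ⟨y, rfl⟩ := hW.span z (suppOn_mono (Set.preimage_mono (Set.Iic_subset_Iic.2 hvu)) hz)
  -- The filling only uses basis elements of level at most `v`, so it stays in the strand of `a`.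
  have hyv := hW.coeff y _ (isLowerSet_Iic v) hz
  rw [hW.isComplexOn.boundaryHom_sum] at hzc
  have hsum : ∑ j, x j • C.chainV u j =
      ∑ i, (Sum.elim x 0 : (C.total T u).ι → k) i • C.totalChain T u i := by
    symm
    refine (Fintype.sum_sum_type _).trans ?_
    refine (congrArg₂ (· + ·) rfl (Finset.sum_eq_zero fun B _ => zero_smul k _)).trans ?_
    exact add_zero _
  rw [hsum] at hzc
  have hDy : ∀ i, (C.total T u).D.mulVec y i = (Sum.elim x 0 : (C.total T u).ι → k) i := by
    intro i
    refine sub_eq_zero.1 (Fintype.linearIndependent_iff.1 hW.linearIndependent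
      (fun i => (C.total T u).D.mulVec y i - (Sum.elim x 0 : (C.total T u).ι → k) i) ?_ i)
    simp only [sub_smul, Finset.sum_sub_distrib]
    exact sub_eq_zero.2 hzc
  -- The differential is block diagonal, so the `V u` component of the filling already fills `x`.
  have hDV : (C.V u).D.mulVec (fun j => y (Sum.inl j)) = x := by
    funext j
    refine Eq.trans ?_ (hDy (Sum.inl j))
    refine Eq.symm ((Fintype.sum_sum_type _).trans ?_)
    refine (congrArg₂ (· + ·) rfl (Finset.sum_eq_zero fun B _ => zero_mul _)).trans ?_
    exact add_zero _
  refine ⟨(C.V u).degPart (e + 1) fun j => y (Sum.inl j), BasedComplex.inDegree_degPart _ _ _,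
    fun j hj => ?_, ?_⟩
  · refine le_trans (hyv (Sum.inl j) fun h => hj ?_) hva
    simp [BasedComplex.degPart, h]
  · rw [BasedComplex.mulVec_degPart, hDV, BasedComplex.degPart_of_inDegree _ hx]

theorem isMinimalFreeResolution (hmin : ∀ i j, m i ≤ m j → i = j) (hm : ∀ i, m i ≠ 0) {J : Type}
    [Fintype J] {τ : J → Fin r} (hτ : Function.Injective τ)
    (hrange : ∀ i, i ∈ label (lcmAtom m) u ↔ i ∈ Set.range τ) {w : J → (C.V u).ι}
    (hw : ∀ t, C.chainV u (w t) = face k {τ t}) {M : Ideal (MvPolynomial (Fin n) k)}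
    (hM : M = Ideal.span (Set.range fun t => monomial (m (τ t)) (1 : k))) :
    ((C.V u).homogenization w fun t => m (τ t)).IsMinimalFreeResolution M := by
  have hl := homMdeg_eq_level (C := C) hmin hm hτ hrange hw
  refine ⟨(isFrame hmin hm hτ hrange hw).isFreeResolution hM fun e he => ?_, fun i j => ?_⟩
  · refine BasedComplex.exactAt_homogenizeWith _ _ e fun a x hx hxa h0 => ?_
    simp only [hl] at hxa ⊢
    exact exists_mulVec_eq hmin hm he a x hx hxa h0
  · change monomial ((C.V u).homMdeg w _ j - (C.V u).homMdeg w _ i) ((C.V u).D i j) ∈ _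
    by_cases hD : (C.V u).D i j = 0
    · rw [hD, map_zero]
      exact Ideal.zero_mem _
    · refine monomial_mem_span_X (fun h => ?_) _
      have h1 := tsub_eq_zero_iff_le.1 h
      exact (level_lt_of_D_ne_zero hmin hm hD).not_ge (((hl j).symm.le.trans h1).trans (hl i).le)

theorem directSum_D_ne_zero {Q : Type} [Fintype Q] [DecidableEq Q] {E : Q → BasedComplex k}
    {i j : Σ q, (E q).ι} (h : (BasedComplex.directSum E).D i j ≠ 0) : i.1 = j.1 := by
  by_contra hpq
  exact h (Matrix.blockDiagonal'_apply_ne (fun q => (E q).D) i.2 j.2 hpq)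

theorem directSum_D_self {Q : Type} [Fintype Q] [DecidableEq Q] {E : Q → BasedComplex k}
    (q : Q) (i j : (E q).ι) : (BasedComplex.directSum E).D ⟨q, i⟩ ⟨q, j⟩ = (E q).D i j :=
  Matrix.blockDiagonal'_apply_eq (fun q => (E q).D) _ _ _

theorem directSum_selection_mdeg_le (T : Set (Finset (Fin r))) (u : LcmLattice m)
    (i j : Σ v : LcmBelow u, (selectionComplex k m T v.1).ι)
    (h : (BasedComplex.directSum fun v : LcmBelow u => selectionComplex k m T v.1).D i j ≠ 0) :
    i.1.1.1 ≤ j.1.1.1 :=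
  le_of_eq (congrArg (fun v : LcmBelow u => v.1.1) (directSum_D_ne_zero h))

/-- The homogenization of the complementary trivial complexes. -/
def selectionHomogenization (k : Type*) [Field k] (T : Set (Finset (Fin r))) (u : LcmLattice m) :
    MultigradedComplex k n :=
  (BasedComplex.directSum fun v : LcmBelow u => selectionComplex k m T v.1).homogenizeWith
    (fun i => i.1.1.1) (directSum_selection_mdeg_le T u)

theorem selectionHomogenization_isTrivial (T : Set (Finset (Fin r))) (u : LcmLattice m) :
    (selectionHomogenization k T u).IsTrivial := by
  have hD : ∀ i j : Σ v : LcmBelow u, (selectionComplex k m T v.1).ι,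
      (selectionHomogenization k T u).D i j = monomial (j.1.1.1 - i.1.1.1)
        ((BasedComplex.directSum fun v : LcmBelow u => selectionComplex k m T v.1).D i j) :=
    fun _ _ => rfl
  refine ⟨Σ v : LcmBelow u, SelectedFace m T v.1, (Equiv.sigmaSumDistrib _ _).symm, ?_, ?_⟩
  · rintro ⟨v, A⟩
    have h1 := (directSum_D_self (E := fun v : LcmBelow u => selectionComplex k m T v.1) v
      (Sum.inr A) (Sum.inl A)).trans (Matrix.one_apply_eq A)
    refine (hD ⟨v, Sum.inr A⟩ ⟨v, Sum.inl A⟩).trans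
      ((congrArg₂ (fun s c => monomial s c) (tsub_self v.1.1) h1).trans ?_)
    rfl
  · rintro ⟨p, i⟩ ⟨q, j⟩ h
    have h' : (BasedComplex.directSum fun v : LcmBelow u =>
        selectionComplex k m T v.1).D ⟨p, i⟩ ⟨q, j⟩ ≠ 0 := by
      intro h0
      refine h ((hD ⟨p, i⟩ ⟨q, j⟩).trans ?_)
      rw [h0, map_zero]
    obtain rfl : p = q := directSum_D_ne_zero h'
    rw [directSum_D_self (E := fun v : LcmBelow u => selectionComplex k m T v.1)] at h'
    rcases i with A | A <;> rcases j with B | B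
    · exact absurd rfl h'
    · exact absurd rfl h'
    · by_cases hAB : A = B
      · subst hAB
        exact ⟨⟨p, A⟩, rfl, rfl⟩
      · exact absurd (Matrix.one_apply_ne hAB) h'
    · exact absurd rfl h'

/-- The trivial complement is the homogenized selection. Every entry of the isomorphism is a
monomial times a coefficient of a basis chain, so evaluation at 1 recovers the chain. -/
theorem isTaylorBasis (hmin : ∀ i j, m i ≤ m j → i = j) (hm : ∀ i, m i ≠ 0) {J : Type}
    [Fintype J] {τ : J → Fin r} (hτ : Function.Injective τ)
    (hrange : ∀ i, i ∈ label (lcmAtom m) u ↔ i ∈ Set.range τ) {w : J → (C.V u).ι}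
    (hw : ∀ t, C.chainV u (w t) = face k {τ t}) :
    IsTaylorBasis m (label (lcmAtom m) u) ((C.V u).homogenization w fun t => m (τ t))
      (C.chainV u) := by
  have hl := homMdeg_eq_level (C := C) hmin hm hτ hrange hw
  obtain ⟨T, hT⟩ := exists_isFaceSelection (k := k) (lcmLevel_mono m)
  have hW := isLeveledBasis (C := C) (u := u) hmin hm hT
  set F := (C.V u).homogenization w fun t => m (τ t) with hF
  set E : MultigradedComplex k n := selectionHomogenization k T u with hE
  let μ : (C.total T u).ι → (Fin n →₀ ℕ) :=
    Sum.elim ((C.V u).homMdeg w fun t => m (τ t)) fun i => i.1.1.1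
  have hμ : ∀ i, μ i = (C.totalLevel T u i).1 := by
    rintro (i | i)
    · exact hl i
    · rfl
  have hμle : ∀ i j, (C.total T u).D i j ≠ 0 → μ i ≤ μ j := by
    intro i j h
    rw [hμ, hμ]
    exact hW.level_le_of_D_ne_zero h
  obtain ⟨Φ, hΦ, hΦe⟩ := hW.exists_homogenizeWith_isIso hμ hμle
  have hD : (F.sum E).D = ((C.total T u).homogenizeWith μ hμle).D := by
    refine Matrix.ext ?_
    rintro (i | i) (j | j)
    · rfl
    · exact (map_zero (monomial (μ (Sum.inr j) - μ (Sum.inl i)))).symm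
    · exact (map_zero (monomial (μ (Sum.inl j) - μ (Sum.inr i)))).symm
    · rfl
  refine ⟨E, selectionHomogenization_isTrivial T u, Φ, ⟨⟨hΦ.1.deg_eq, hΦ.1.bijective, ?_⟩, hΦ.2⟩,
    fun i => ⟨fun A => ?_, ?_⟩⟩
  · have h1 := hΦ.1.comm
    rw [← hD] at h1
    exact h1
  · have h1 := hΦe A (Sum.inl i)
    refine Eq.trans ?_ (congrArg (MvPolynomial.eval fun _ => 1) h1).symm
    rw [eval_monomial]
    simp
    rfl
  · intro A hA
    by_contra hne
    exact hA (lcmLevel_le_iff.1 (le_trans ((hW.hasLevel (Sum.inl i)).1 A hne)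
      (hW.level_le (Sum.inl i))))

end TaylorConstruction

end Resolution

/-! ### Assembly of the theorem. -/

namespace TaylorConstruction

variable {k : Type*} [Field k] {n r : ℕ} {m : Fin r → (Fin n →₀ ℕ)}

theorem exists_resolution (C : TaylorConstruction k (lcmAtom m))
    (hmin : ∀ i j, m i ≤ m j → i = j) (hm : ∀ i, m i ≠ 0) (u : LcmLattice m) {J : Type}
    [Fintype J] {τ : J → Fin r} (hτ : Function.Injective τ)
    (hrange : ∀ i, i ∈ label (lcmAtom m) u ↔ i ∈ Set.range τ)
    {M : Ideal (MvPolynomial (Fin n) k)}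
    (hM : M = Ideal.span (Set.range fun t => monomial (m (τ t)) (1 : k))) :
    ∃ w : J → (C.V u).ι, (∀ t, C.chainV u (w t) = face k {τ t}) ∧ (C.V u).IsFrame w ∧
      ((C.V u).homogenization w fun t => m (τ t)).IsMinimalFreeResolution M ∧
      IsTaylorBasis m (label (lcmAtom m) u) ((C.V u).homogenization w fun t => m (τ t))
        (C.chainV u) := by
  have h : ∀ t, ∃ j, C.chainV u j = face k {τ t} := fun t =>
    exists_chainV_eq (v := lcmAtom m (τ t)) (mem_label.1 ((hrange _).2 ⟨t, rfl⟩))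
      (by rw [C.Γ_atom]; exact Set.mem_singleton _)
  choose w hw using h
  exact ⟨w, hw, isFrame hmin hm hτ hrange hw, isMinimalFreeResolution hmin hm hτ hrange hw hM,
    isTaylorBasis hmin hm hτ hrange hw⟩

end TaylorConstruction

end
theorem theorem3 {k : Type*} [Field k] {n r : ℕ}
    (m : Fin r → (Fin n →₀ ℕ)) (hmin : ∀ i j, m i ≤ m j → i = j)
    (M : Ideal (MvPolynomial (Fin n) k))
    (hM : M = Ideal.span (Set.range fun i => MvPolynomial.monomial (m i) (1 : k)))
    (hproper : M ≠ ⊤)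
    (C : TaylorConstruction k (lcmAtom m)) :
    (∀ u, u ≠ ⊥ → ∀ c ∈ C.Γ u, IsTaylorChainAt (lcmAtom m) u c) ∧
    (∃ (P : LcmLattice m → Set (Chain k r)) (E : LcmLattice m → BasedComplex k)
      (chainE : ∀ v, (E v).ι → Chain k r), ∀ u, u ≠ ⊥ →
        (∀ c ∈ P u, IsTaylorChainAt (lcmAtom m) u c) ∧
        IsComplexOn (P u) (E u) (chainE u) ∧ (E u).IsTrivial ∧
        IsComplexOn ((⋃ v ≤ u, C.Γ v) ∪ ⋃ v, ⋃ (_ : v ≠ ⊥ ∧ v ≤ u), P v)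
          (sumBelow u (C.V u) E) (sumBelowChain u (C.chainV u) chainE) ∧
        LinearIndependent k (sumBelowChain u (C.chainV u) chainE) ∧
        (∃ Φ, (sumBelow u (C.V u) E).IsIso (simplexComplex k (label (lcmAtom m) u)) Φ) ∧
        ∃ hμ, ∃ Φ,
          ((sumBelow u (C.V u) E).homogenizeWith
            (fun i => chainMdeg m (sumBelowChain u (C.chainV u) chainE i)) hμ).IsIso
            (taylorComplex k m (label (lcmAtom m) u)) Φ) ∧
    (∀ u, u ≠ ⊥ → ∃ w : label (lcmAtom m) u → (C.V u).ι,
      (∀ i, C.chainV u (w i) = face k {i.1}) ∧ (C.V u).IsFrame w ∧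
      ((C.V u).homogenization w fun i => m i.1).IsMinimalFreeResolution
        (monomialIdeal k m (label (lcmAtom m) u)) ∧
      IsTaylorBasis m (label (lcmAtom m) u)
        ((C.V u).homogenization w fun i => m i.1) (C.chainV u)) ∧
    ∃ w : Fin r → (C.V (lcmTop m)).ι,
      (∀ i, C.chainV (lcmTop m) (w i) = face k {i}) ∧ (C.V (lcmTop m)).IsFrame w ∧
      ((C.V (lcmTop m)).homogenization w m).IsMinimalFreeResolution M ∧
      IsTaylorBasis m Finset.univ ((C.V (lcmTop m)).homogenization w m) (C.chainV (lcmTop m)) ∧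
      Set.range (C.chainV (lcmTop m)) = ⋃ u, C.Γ u := by
  -- Properness of `M` enters only here: no generator is 1, so atoms differ from the bottom element.
  have hm : ∀ i, m i ≠ 0 := ne_zero_of_span_ne_top (hM ▸ hproper)
  refine ⟨fun u _ c hc => ((C.isRelativeHomologyBasis hmin hm u).hasLevel hc).isTaylorChainAt,
    ?_, fun u _ => ?_, ?_⟩
  -- One selection is fixed for all levels, since the sets `P v` must not depend on `u`.
  · obtain ⟨T, hT⟩ := exists_isFaceSelection (k := k) (lcmLevel_mono m)
    refine ⟨fun v => Set.range (selectionChain k m T v), selectionComplex k m T,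
      selectionChain k m T, fun u hu => ?_⟩
    have hW := TaylorConstruction.isLeveledBasis (C := C) (u := u) hmin hm hT
    have hmdeg := fun i => (hW.hasLevel i).chainMdeg_eq
    refine ⟨?_, ⟨?_, rfl, selectionChain_homogeneous hT u, boundary_selectionChain T u⟩,
      selectionComplex_isTrivial T u, ⟨hW.linearIndependent.injective, ?_, hW.homogeneous,
        hW.boundary_eq⟩, hW.linearIndependent, hW.exists_isIso, ?_⟩
    · rintro _ ⟨i, rfl⟩
      exact (hasLevel_selectionChain hT u i).isTaylorChainAt
    · intro i j h
      have h1 := hW.linearIndependent.injective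
        (a₁ := Sum.inr ⟨⟨u, hu, le_rfl⟩, i⟩) (a₂ := Sum.inr ⟨⟨u, hu, le_rfl⟩, j⟩) h
      exact eq_of_heq (Sigma.mk.inj (Sum.inr_injective h1)).2
    · refine (Set.Sum.elim_range _ _).trans (congrArg₂ (· ∪ ·) (C.complexV u).range_eq ?_)
      ext c
      simp only [Set.mem_range, Set.mem_iUnion]
      constructor
      · rintro ⟨⟨v, i⟩, rfl⟩
        exact ⟨v.1, v.2, i, rfl⟩
      · rintro ⟨v, hv, i, rfl⟩
        exact ⟨⟨⟨v, hv⟩, i⟩, rfl⟩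
    -- The multidegree of each basis chain is its level, so divisibility along the differential
    -- follows from the order on levels.
    · have hμ : ∀ i j, (C.total T u).D i j ≠ 0 →
          chainMdeg m (C.totalChain T u i) ≤ chainMdeg m (C.totalChain T u j) := by
        intro i j h
        rw [hmdeg, hmdeg]
        exact hW.level_le_of_D_ne_zero h
      obtain ⟨Φ, hΦ, -⟩ := hW.exists_homogenizeWith_isIso hmdeg hμ
      exact ⟨hμ, Φ, hΦ⟩
  · refine C.exists_resolution hmin hm u (τ := Subtype.val) Subtype.val_injective (by simp) ?_
    rw [monomialIdeal, Set.image_eq_range]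
    rfl
  · have htop : label (lcmAtom m) (lcmTop m) = Finset.univ :=
      Finset.eq_univ_of_forall fun i => mem_label.2 (Finset.le_sup (Finset.mem_univ i))
    obtain ⟨w, h1, h2, h3, h4⟩ := C.exists_resolution hmin hm (lcmTop m) (τ := id)
      Function.injective_id (by simp [htop]) hM
    rw [htop] at h4
    refine ⟨w, h1, h2, h3, h4, ?_⟩
    rw [(C.complexV _).range_eq]
    refine Set.iUnion_congr fun u => ?_
    have hu : u ≤ lcmTop m := by
      obtain ⟨A, rfl⟩ := lcmLevel_surjective m u
      exact Finset.sup_mono (f := m) (Finset.subset_univ A)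
    simp [hu]
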